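/- Let $M=(|M|,\mathcal O_M)$ be a smooth supermanifold of dimension $n|m$, i.e. a Hausdorff second countable space with a sheaf of supercommutative real algebras that is locally isomorphic to $\mathbb R^{n|m}=(\mathbb R^n, C^\infty\otimes\Lambda(\theta^1,\dots,\theta^m))$, and put $C^\infty(M)=\mathcal O_M(|M|)$. A vector field on $M$ is a superderivation of the sheaf $\mathcal O_M$ (a sum of an even and an odd one); $\widetilde X\in\mathbb Z/2$ denotes the parity of a homogeneous vector field $X$, and $[X,Y]=X\circ Y-(-1)^{\widetilde X\widetilde Y}\,Y\circ X$ for homogeneous $X,Y$, extended bilinearly. Let $Q$ be a homological vector field on $M$, i.e. an odd vector field with $Q^2=0$. Let $\boldsymbol\rho$ be a Berezin volume on $M$: in local coordinates $x^a$ (of parity $\widetilde a$) $\boldsymbol\rho=D[x]\,\rho(x)$ with $\rho$ even and invertible, where $D[x']=D[x]\,\mathrm{Ber}(\partial x'/\partial x)$ under changes of coordinates. For a homogeneous vector field $X$ the divergence $\mathrm{Div}_{\boldsymbol\rho}X\in C^\infty(M)$ is defined by $\boldsymbol\rho\,\mathrm{Div}_{\boldsymbol\rho}X=L_X\boldsymbol\rho$,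 that is, in every system of local coordinates, with $X^a=X(x^a)$, $$\mathrm{Div}_{\boldsymbol\rho}X=\sum_a(-1)^{\widetilde a(\widetilde X+1)}\,\frac1\rho\,\frac{\partial (X^a\rho)}{\partial x^a}.$$ Then: 1. For every homogeneous vector field $X$ on $M$, $\mathrm{Div}_{\boldsymbol\rho}X$ is well defined: there is exactly one function on $M$ given in all local coordinates by this formula. 2. If $X$ is a homogeneous vector field with $[X,Q]=0$, then $$X(\mathrm{Div}_{\boldsymbol\rho}Q)=(-1)^{\widetilde X}\,Q(\mathrm{Div}_{\boldsymbol\rho}X).$$ 3. For every (not necessarily homogeneous) vector field $X$ with $[X,Q]=0$, the function $X(\mathrm{Div}_{\boldsymbol\rho}Q)$ is $Q$-exact, i.e. equal to $Q(g)$ for some $g\in C^\infty(M)$. -/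

import Mathlib

open CategoryTheory TopologicalSpace Opposite
open scoped TensorProduct ContDiff

universe u

namespace SuperGeom

/-- The sign `(-1)^p` of a parity `p ∈ ℤ/2`. -/
def sgn (p : ZMod 2) : ℝ := (-1) ^ p.val

/-! ### Supercommutative algebras and the Berezinian -/

/-- `gr 0` and `gr 1` are the even and odd parts of a supercommutative real algebra `R`. -/
structure IsSuperCommAlgebra {R : Type*} [Ring R] [Algebra ℝ R]
    (gr : ZMod 2 → Submodule ℝ R) : Prop where
  graded : SetLike.GradedMonoid gr
  isCompl : IsCompl (gr 0) (gr 1)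
  super_comm : ∀ (p q : ZMod 2) (a b : R), a ∈ gr p → b ∈ gr q →
    a * b = sgn (p * q) • (b * a)

/-- The determinant given by the Leibniz formula (the factors being taken in increasing order of the
column index). It is only used for matrices with pairwise commuting (even) entries. -/
def leibnizDet {R : Type*} [Ring R] {k : ℕ} (A : Matrix (Fin k) (Fin k) R) : R :=
  ∑ σ : Equiv.Perm (Fin k),
    ((Equiv.Perm.sign σ : ℤˣ) : ℤ) • (List.ofFn fun i => A (σ i) i).prod

/-- On matrices with entries in a commutative ring, `leibnizDet` is the determinant. -/
theorem leibnizDet_eq_det {R : Type*} [CommRing R] {k : ℕ} (A : Matrix (Fin k) (Fin k) R) :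
    leibnizDet A = A.det := by
  simp [leibnizDet, Matrix.det_apply', List.prod_ofFn]

/-- The Berezinian `Ber J = det (A - B D⁻¹ C) · (det D)⁻¹` of an even invertible supermatrix
`J = (A B; C D)`, where `A`, `D` have even entries and `B`, `C` have odd entries. -/
noncomputable def berezinian {R : Type*} [Ring R] {n m : ℕ}
    (J : Matrix (Fin n ⊕ Fin m) (Fin n ⊕ Fin m) R) : R :=
  leibnizDet (J.toBlocks₁₁ - J.toBlocks₁₂ * Ring.inverse J.toBlocks₂₂ * J.toBlocks₂₁) *
    Ring.inverse (leibnizDet J.toBlocks₂₂)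

/-! ### The model `ℝ^{n|m}`: the algebras `C^∞(W) ⊗ Λ(θ¹, …, θᵐ)` -/

/-- The space `ℝⁿ`. -/
abbrev Rn (n : ℕ) : Type := EuclideanSpace ℝ (Fin n)

/-- The smooth real functions on an open set `W ⊆ ℝⁿ`. -/
noncomputable def smoothFun {n : ℕ} (W : Opens (Rn n)) : Subalgebra ℝ (W → ℝ) where
  carrier := {f | ContDiffOn ℝ ∞ (Function.extend Subtype.val f 0) (W : Set (Rn n))}
  mul_mem' := by
    intro f g hf hg
    refine (ContDiffOn.mul hf hg).congr fun x hx => ?_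
    have h := fun k : W → ℝ => Subtype.val_injective.extend_apply k (0 : Rn n → ℝ) ⟨x, hx⟩
    simp only at h
    simp [h]
  add_mem' := by
    intro f g hf hg
    refine (ContDiffOn.add hf hg).congr fun x hx => ?_
    have h := fun k : W → ℝ => Subtype.val_injective.extend_apply k (0 : Rn n → ℝ) ⟨x, hx⟩
    simp only at h
    simp [h]
  algebraMap_mem' := by
    intro r
    refine (contDiffOn_const (c := r)).congr fun x hx => ?_
    have h := fun k : W → ℝ => Subtype.val_injective.extend_apply k (0 : Rn n → ℝ) ⟨x, hx⟩
    simp only at h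
    simp [h]

/-- A function on `ℝⁿ` that is smooth on `W` restricts to a smooth function on `W`. -/
theorem mem_smoothFun_of_contDiffOn {n : ℕ} {W : Opens (Rn n)} {F : Rn n → ℝ}
    (hF : ContDiffOn ℝ ∞ F (W : Set (Rn n))) : (fun x : W => F x) ∈ smoothFun W := by
  refine ContDiffOn.congr hF fun x hx => ?_
  exact Subtype.val_injective.extend_apply (fun x : W => F x) (0 : Rn n → ℝ) ⟨x, hx⟩

/-- Restriction of smooth functions from `W` to `W' ⊆ W`. -/
noncomputable def smoothRes {n : ℕ} {W' W : Opens (Rn n)} (h : W' ≤ W) :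
    smoothFun W →ₐ[ℝ] smoothFun W' where
  toFun f := ⟨fun x => f.1 ⟨x.1, h x.2⟩, by
    have hf : ContDiffOn ℝ ∞ (Function.extend Subtype.val f.1 0) (W : Set (Rn n)) := f.2
    refine (hf.mono h).congr fun x hx => ?_
    have h1 := Subtype.val_injective.extend_apply f.1 (0 : Rn n → ℝ) ⟨x, h hx⟩
    have h2 := Subtype.val_injective.extend_apply (fun x : W' => f.1 ⟨x.1, h x.2⟩)
      (0 : Rn n → ℝ) ⟨x, hx⟩
    simp only at h1 h2
    rw [h1, h2]⟩
  map_one' := rfl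
  map_mul' _ _ := rfl
  map_zero' := rfl
  map_add' _ _ := rfl
  commutes' _ := rfl

/-- The partial derivative `∂/∂x^μ` of smooth functions on `W`. -/
noncomputable def smoothPartial {n : ℕ} (W : Opens (Rn n)) (μ : Fin n) :
    smoothFun W →ₗ[ℝ] smoothFun W where
  toFun f := ⟨fun x => fderiv ℝ (Function.extend Subtype.val f.1 0) x
      (EuclideanSpace.single μ (1 : ℝ)), by
    have hf : ContDiffOn ℝ ∞ (Function.extend Subtype.val f.1 0) (W : Set (Rn n)) := f.2
    exact mem_smoothFun_of_contDiffOn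
      ((hf.fderiv_of_isOpen W.isOpen le_rfl).clm_apply contDiffOn_const)⟩
  map_add' f g := by
    have hd : ∀ k : smoothFun W, ∀ x : W,
        DifferentiableAt ℝ (Function.extend Subtype.val k.1 (0 : Rn n → ℝ)) x := fun k x =>
      (ContDiffOn.contDiffAt (s := (W : Set (Rn n))) k.2
        (W.isOpen.mem_nhds x.2)).differentiableAt (by simp)
    ext x
    have e : Function.extend Subtype.val (f + g).1 (0 : Rn n → ℝ) =
        Function.extend Subtype.val f.1 0 + Function.extend Subtype.val g.1 0 := by
      have := Function.extend_add (Subtype.val : W → Rn n) f.1 g.1 (0 : Rn n → ℝ) 0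
      simpa using this
    simp only [e]
    rw [fderiv_add (hd f x) (hd g x)]
    rfl
  map_smul' r f := by
    have hd : ∀ k : smoothFun W, ∀ x : W,
        DifferentiableAt ℝ (Function.extend Subtype.val k.1 (0 : Rn n → ℝ)) x := fun k x =>
      (ContDiffOn.contDiffAt (s := (W : Set (Rn n))) k.2
        (W.isOpen.mem_nhds x.2)).differentiableAt (by simp)
    ext x
    have e : Function.extend Subtype.val (r • f).1 (0 : Rn n → ℝ) =
        r • Function.extend Subtype.val f.1 0 := by
      have := Function.extend_smul r (Subtype.val : W → Rn n) f.1 (0 : Rn n → ℝ)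
      simpa using this
    simp only [e]
    rw [fderiv_const_smul (hd f x)]
    rfl

/-- The coordinate function `x^μ` on `W`. -/
noncomputable def smoothCoord {n : ℕ} (W : Opens (Rn n)) (μ : Fin n) : smoothFun W :=
  ⟨fun x => (x : Rn n) μ,
    mem_smoothFun_of_contDiffOn (F := fun x : Rn n => x μ) (by fun_prop)⟩

/-- The Grassmann algebra `Λ(θ¹, …, θᵐ)`. -/
abbrev Grassmann (m : ℕ) : Type := ExteriorAlgebra ℝ (Fin m → ℝ)

/-- The algebra `C^∞(W) ⊗ Λ(θ¹, …, θᵐ)` of functions on the superdomain over `W`. -/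
abbrev ModelAlg {n : ℕ} (m : ℕ) (W : Opens (Rn n)) : Type := smoothFun W ⊗[ℝ] Grassmann m

/-- The even and odd parts of `C^∞(W) ⊗ Λ`, spanned by `f ⊗ ω` with `ω` even, resp. odd. -/
noncomputable def modelParity {n : ℕ} (m : ℕ) (W : Opens (Rn n)) (p : ZMod 2) :
    Submodule ℝ (ModelAlg m W) :=
  ((CliffordAlgebra.evenOdd (0 : QuadraticForm ℝ (Fin m → ℝ)) p).baseChange
    (smoothFun W)).restrictScalars ℝ

/-- Restriction of functions on superdomains. -/
noncomputable def modelRes {n : ℕ} (m : ℕ) {W' W : Opens (Rn n)} (h : W' ≤ W) :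
    ModelAlg m W →ₐ[ℝ] ModelAlg m W' :=
  Algebra.TensorProduct.map (smoothRes h) (AlgHom.id ℝ (Grassmann m))

/-- The standard coordinates `(x^μ, θ^i)` on the superdomain over `W`. -/
noncomputable def modelCoord {n m : ℕ} (W : Opens (Rn n)) : Fin n ⊕ Fin m → ModelAlg m W
  | Sum.inl μ => smoothCoord W μ ⊗ₜ 1
  | Sum.inr i => 1 ⊗ₜ ExteriorAlgebra.ι ℝ (Pi.single i (1 : ℝ))

/-- The standard (left) partial derivatives `∂/∂x^μ`, `∂/∂θ^i` on the superdomain over `W`; the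
latter is the contraction of forms with the `i`-th coordinate functional. -/
noncomputable def modelPartial {n m : ℕ} (W : Opens (Rn n)) :
    Fin n ⊕ Fin m → (ModelAlg m W →ₗ[ℝ] ModelAlg m W)
  | Sum.inl μ => (smoothPartial W μ).rTensor (Grassmann m)
  | Sum.inr i => (CliffordAlgebra.contractLeft (Q := (0 : QuadraticForm ℝ (Fin m → ℝ)))
      (LinearMap.proj i)).lTensor (smoothFun W)

/-- The parity of the coordinates: the `x^μ` are even, the `θ^i` are odd. -/
def idxParity {n m : ℕ} : Fin n ⊕ Fin m → ZMod 2
  | Sum.inl _ => 0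
  | Sum.inr _ => 1

/-! ### Supermanifolds -/

/-- A topological space with a sheaf of supercommutative real algebras. -/
structure SuperSpace where
  space : TopCat.{u}
  sheaf : TopCat.Sheaf (AlgCat.{u} ℝ) space
  /-- The even and odd parts of the algebras of sections. -/
  parity : ∀ U : Opens space, ZMod 2 → Submodule ℝ (sheaf.presheaf.obj (op U))
  isSuper : ∀ U, IsSuperCommAlgebra (parity U)
  res_mem_parity : ∀ {U V : Opens space} (h : U ≤ V) (p : ZMod 2)
    (f : sheaf.presheaf.obj (op V)), f ∈ parity V p →
      (sheaf.presheaf.map (homOfLE h).op).hom f ∈ parity U p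

namespace SuperSpace

/-- The algebra of sections of the structure sheaf over `U`. -/
abbrev O (M : SuperSpace.{u}) (U : Opens M.space) : Type u := M.sheaf.presheaf.obj (op U)

/-- Restriction of sections of the structure sheaf. -/
noncomputable def res (M : SuperSpace.{u}) {U V : Opens M.space} (h : U ≤ V) :
    M.O V →ₐ[ℝ] M.O U :=
  (M.sheaf.presheaf.map (homOfLE h).op).hom

end SuperSpace

/-- The image of `W` (intersected with the source of `e`) under the local homeomorphism `e`. -/
def imageOpens {X : Type*} [TopologicalSpace X] {n : ℕ} (e : OpenPartialHomeomorph X (Rn n))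
    (W : Opens X) : Opens (Rn n) :=
  ⟨e.target ∩ e.symm ⁻¹' W, e.symm.isOpen_inter_preimage W.isOpen⟩

theorem imageOpens_mono {X : Type*} [TopologicalSpace X] {n : ℕ}
    (e : OpenPartialHomeomorph X (Rn n)) {W' W : Opens X} (h : W' ≤ W) :
    imageOpens e W' ≤ imageOpens e W :=
  fun _ hx => ⟨hx.1, h hx.2⟩

/-- A chart of dimension `n|m`: an isomorphism of superringed spaces from an open part of `M` onto
an open part of `ℝ^{n|m}`, i.e. a homeomorphism `e` from an open set of `M` onto an open
set of `ℝⁿ` and parity preserving isomorphisms of algebras `O_M(W) ≅ C^∞(e(W)) ⊗ Λ(θ¹, …, θᵐ)`, for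
the open sets `W` of the domain of `e`, which commute with the restrictions. -/
structure Chart (M : SuperSpace.{u}) (n m : ℕ) where
  e : OpenPartialHomeomorph M.space (Rn n)
  iso : ∀ W : Opens M.space, (W : Set M.space) ⊆ e.source →
    (M.O W ≃ₐ[ℝ] ModelAlg m (imageOpens e W))
  iso_parity : ∀ W hW p f, f ∈ M.parity W p ↔ iso W hW f ∈ modelParity m (imageOpens e W) p
  iso_res : ∀ (W' W : Opens M.space) (h : W' ≤ W) (hW : (W : Set M.space) ⊆ e.source) (f : M.O W),
    iso W' (le_trans h hW) (M.res h f) = modelRes m (imageOpens_mono e h) (iso W hW f)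

namespace Chart

variable {M : SuperSpace.{u}} {n m : ℕ}

/-- The domain of a chart. -/
def dom (c : Chart M n m) : Opens M.space := ⟨c.e.source, c.e.open_source⟩

/-- The local coordinates `x^a = (x^μ, θ^i)` of the chart `c`, restricted to `W`. -/
noncomputable def coord (c : Chart M n m) {W : Opens M.space} (hW : W ≤ c.dom)
    (a : Fin n ⊕ Fin m) : M.O W :=
  (c.iso W hW).symm (modelCoord (imageOpens c.e W) a)

/-- The partial derivatives `∂/∂x^a` of the chart `c`, on functions on `W`. -/
noncomputable def partialD (c : Chart M n m) {W : Opens M.space} (hW : W ≤ c.dom)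
    (a : Fin n ⊕ Fin m) : M.O W →ₗ[ℝ] M.O W :=
  (c.iso W hW).symm.toLinearMap ∘ₗ modelPartial (imageOpens c.e W) a ∘ₗ
    (c.iso W hW).toLinearMap

/-- The Jacobi matrix `∂x'/∂x`, with the entry `∂x'^b/∂x^a` in row `a` and column `b`, of the
change from the coordinates `x` of `c` to the coordinates `x'` of `c'`, on the common domain. -/
noncomputable def jacobian (c c' : Chart M n m) :
    Matrix (Fin n ⊕ Fin m) (Fin n ⊕ Fin m) (M.O (c.dom ⊓ c'.dom)) :=
  Matrix.of fun a b => c.partialD inf_le_left a (c'.coord inf_le_right b)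

end Chart

/-- A supermanifold of dimension `n|m`: a space with a sheaf of supercommutative algebras that is
locally isomorphic to `ℝ^{n|m}` (so that its stalks are local), the space being
Hausdorff and second countable. -/
structure Supermanifold (n m : ℕ) extends SuperSpace.{u} where
  t2 : T2Space space
  secondCountable : SecondCountableTopology space
  locally_model : ∀ x : space, ∃ c : Chart toSuperSpace n m, x ∈ c.dom

variable {n m : ℕ}

/-- The algebra `C^∞(M)` of functions on `M`. -/
abbrev Supermanifold.Functions (M : Supermanifold.{u} n m) : Type u := M.O ⊤

/-! ### Vector fields -/

/-- A homogeneous vector field of parity `p` on `M`: a superderivation of parity `p` of the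
structure sheaf. -/
structure HomVectorField (M : Supermanifold.{u} n m) (p : ZMod 2) where
  toFun : ∀ U : Opens M.space, M.O U →ₗ[ℝ] M.O U
  map_res : ∀ {U V : Opens M.space} (h : U ≤ V) (f : M.O V),
    toFun U (M.res h f) = M.res h (toFun V f)
  map_parity : ∀ (U : Opens M.space) (q : ZMod 2) (f : M.O U),
    f ∈ M.parity U q → toFun U f ∈ M.parity U (p + q)
  leibniz : ∀ (U : Opens M.space) (q : ZMod 2) (f g : M.O U), f ∈ M.parity U q →
    toFun U (f * g) = toFun U f * g + sgn (p * q) • (f * toFun U g)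

/-- The value of the vector field `X` on a global function. -/
def HomVectorField.apply {M : Supermanifold.{u} n m} {p : ZMod 2} (X : HomVectorField M p)
    (f : M.Functions) : M.Functions := X.toFun ⊤ f

/-- The supercommutator `[X, Y] = X ∘ Y - (-1)^{pq} Y ∘ X` of homogeneous vector fields. -/
def superBracket {M : Supermanifold.{u} n m} {p q : ZMod 2} (X : HomVectorField M p)
    (Y : HomVectorField M q) (U : Opens M.space) : M.O U →ₗ[ℝ] M.O U :=
  X.toFun U ∘ₗ Y.toFun U - sgn (p * q) • (Y.toFun U ∘ₗ X.toFun U)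

/-- A (not necessarily homogeneous) vector field: the sum of an even and an odd one. -/
structure VectorField (M : Supermanifold.{u} n m) where
  even : HomVectorField M 0
  odd : HomVectorField M 1

/-- The value of a vector field on a global function. -/
def VectorField.apply {M : Supermanifold.{u} n m} (X : VectorField M) (f : M.Functions) :
    M.Functions := X.even.apply f + X.odd.apply f

/-- `Q` is a homological vector field: it is odd and `Q² = 0`. -/
def IsHomological {M : Supermanifold.{u} n m} (Q : HomVectorField M 1) : Prop :=
  ∀ U : Opens M.space, Q.toFun U ∘ₗ Q.toFun U = 0

/-- The homogeneous vector field `X` is a symmetry of `Q`: `[X, Q] = 0`. -/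
def HomVectorField.IsSymmetry {M : Supermanifold.{u} n m} {p : ZMod 2} (X : HomVectorField M p)
    (Q : HomVectorField M 1) : Prop :=
  ∀ U : Opens M.space, superBracket X Q U = 0

/-- The vector field `X` is a symmetry of `Q`: `[X, Q] = 0`. -/
def VectorField.IsSymmetry {M : Supermanifold.{u} n m} (X : VectorField M)
    (Q : HomVectorField M 1) : Prop :=
  ∀ U : Opens M.space, superBracket X.even Q U + superBracket X.odd Q U = 0

/-- The function `f` is `Q`-exact. -/
def IsExact {M : Supermanifold.{u} n m} (Q : HomVectorField M 1) (f : M.Functions) : Prop :=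
  ∃ g : M.Functions, f = Q.apply g

/-! ### Berezin volumes and the divergence -/

/-- A Berezin form, i.e. a section of the Berezin bundle: it is `D[x] s(x)` in each chart, where
`D[x'] = D[x] Ber(∂x'/∂x)` under a change of coordinates. -/
structure BerezinForm (M : Supermanifold.{u} n m) where
  coeff : ∀ c : Chart M.toSuperSpace n m, M.O c.dom
  transform : ∀ c c' : Chart M.toSuperSpace n m,
    M.res (inf_le_left : c.dom ⊓ c'.dom ≤ c.dom) (coeff c) =
      berezinian (c.jacobian c') *
        M.res (inf_le_right : c.dom ⊓ c'.dom ≤ c'.dom) (coeff c')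

/-- A Berezin volume: a nowhere vanishing even Berezin form. -/
structure BerezinVolume (M : Supermanifold.{u} n m) extends BerezinForm M where
  even : ∀ c, coeff c ∈ M.parity c.dom 0
  isUnit : ∀ c, IsUnit (coeff c)

/-- The coefficient `∑_a (-1)^{ã(X̃+1)} ∂(X^a s)/∂x^a`, in the chart `c`, of the Lie derivative of
the Berezin form `D[x] s(x)` along `X`, where `X^a = X(x^a)`. -/
noncomputable def lieCoeff {M : Supermanifold.{u} n m} {p : ZMod 2} (X : HomVectorField M p)
    (s : BerezinForm M) (c : Chart M.toSuperSpace n m) : M.O c.dom :=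
  ∑ a : Fin n ⊕ Fin m, sgn (idxParity a * (p + 1)) •
    c.partialD le_rfl a (X.toFun c.dom (c.coord le_rfl a) * s.coeff c)

/-- The function `f` is a divergence of `X` with respect to `ρ`: `ρ f = L_X ρ`, in every chart. -/
def IsDivergence {M : Supermanifold.{u} n m} (ρ : BerezinVolume M) {p : ZMod 2}
    (X : HomVectorField M p) (f : M.Functions) : Prop :=
  ∀ c : Chart M.toSuperSpace n m,
    ρ.coeff c * M.res le_top f = lieCoeff X ρ.toBerezinForm c

open Classical in
/-- The divergence `Div_ρ X`: the function `f` with `ρ f = L_X ρ` (and `0` if there were none). -/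
noncomputable def divergence {M : Supermanifold.{u} n m} (ρ : BerezinVolume M) {p : ZMod 2}
    (X : HomVectorField M p) : M.Functions :=
  if h : ∃ f, IsDivergence ρ X f then h.choose else 0

end SuperGeom

namespace SuperGeom

/-! ### Signs -/

/-! Everything is reduced to identities in one chart. There a superderivation `X` equals `∑ X(x^a)
∂_a` (`LocalSuperDer.expands`), and the Leibniz rule splits the Lie derivative of the density `s`
into a coordinate divergence times `s` plus `X s` (`SuperCoords.lie_eq`); hence `Div X = coordDiv X
+ s⁻¹ X(s)`.

Well-definedness: a change of coordinates alters `coordDiv X` by a sum of second derivatives of the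
new coordinates contracted with the inverse Jacobi matrix (`SuperCoords.coordDiv_change`). This is
the supertrace of `J⁻¹ X(J)`, which is the logarithmic derivative of the Berezinian
(`berezinian_logDeriv`, a super version of Jacobi's formula). So `L_X ρ` transforms by the same
Berezinian as `ρ` (`lie_change`), the quotients agree on overlaps, and the sheaf property glues
them.

Symmetry: when `X` and `Y` supercommute, `X(coordDiv Y)` is a signed sum of the terms `∂_a(X Y x^a)`
minus the supertrace of a product of two matrices of first derivatives, and both are supersymmetric
in `X`, `Y`. So is `X(s⁻¹ Y s)`, being `s⁻¹ XY s - s⁻² (X s)(Y s)`. Taking `Y = Q` gives the second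
claim. For the third, the two homogeneous brackets of a mixed symmetry have opposite parities, so
each vanishes and the primitives add up.

The expansion in coordinates is the analytic input. A derivation killing the coordinates is zero
because, by Hadamard's lemma, a smooth function minus its value at a point lies locally in the ideal
generated by the `x^μ - x^μ(p)`; the derivation preserves this ideal, whose elements vanish at `p`.
-/

@[simp] theorem sgn_zero : sgn 0 = 1 := by simp [sgn]

@[simp] theorem sgn_one : sgn 1 = -1 := by simp [sgn, ZMod.val_one]

theorem sgn_add (p q : ZMod 2) : sgn (p + q) = sgn p * sgn q := by
  have key : ∀ p q : ZMod 2, (p + q).val % 2 = (p.val + q.val) % 2 := by decide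
  rw [sgn, sgn, sgn, ← pow_add, neg_one_pow_eq_pow_mod_two, key, ← neg_one_pow_eq_pow_mod_two]

theorem sgn_mul_self (p : ZMod 2) : sgn p * sgn p = 1 := by
  rw [← sgn_add, CharTwo.add_self_eq_zero, sgn_zero]

theorem sgn_smul_smul {V : Type*} [AddCommGroup V] [Module ℝ V] (p q : ZMod 2) (v : V) :
    sgn p • sgn q • v = sgn (p + q) • v := by
  rw [smul_smul, sgn_add]

/-! ### Supercommutative algebras and superderivations -/

section Algebra

variable {R : Type*} [Ring R] [Algebra ℝ R] {gr : ZMod 2 → Submodule ℝ R}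

/-- `D` is a superderivation of parity `p`. -/
structure IsSuperDer (gr : ZMod 2 → Submodule ℝ R) (p : ZMod 2) (D : R →ₗ[ℝ] R) : Prop where
  map_parity : ∀ (q : ZMod 2) (f : R), f ∈ gr q → D f ∈ gr (p + q)
  leibniz : ∀ (q : ZMod 2) (f g : R), f ∈ gr q → D (f * g) = D f * g + sgn (p * q) • (f * D g)

namespace IsSuperCommAlgebra

theorem one_mem (h : IsSuperCommAlgebra gr) : (1 : R) ∈ gr 0 := h.graded.one_mem

theorem mul_mem (h : IsSuperCommAlgebra gr) {p q : ZMod 2} {a b : R} (ha : a ∈ gr p)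
    (hb : b ∈ gr q) : a * b ∈ gr (p + q) := h.graded.mul_mem ha hb

theorem exists_add (h : IsSuperCommAlgebra gr) (f : R) : ∃ a ∈ gr 0, ∃ b ∈ gr 1, a + b = f :=
  Submodule.mem_sup.1 (by rw [h.isCompl.sup_eq_top]; trivial)

theorem eq_zero_of_mem (h : IsSuperCommAlgebra gr) {p : ZMod 2} {f : R} (h0 : f ∈ gr p)
    (h1 : f ∈ gr (p + 1)) : f = 0 := by
  fin_cases p
  · exact Submodule.disjoint_def.1 h.isCompl.disjoint f h0 h1
  · exact Submodule.disjoint_def.1 h.isCompl.disjoint f h1 h0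

theorem even_mul_comm (h : IsSuperCommAlgebra gr) {a : R} (ha : a ∈ gr 0) (b : R) :
    a * b = b * a := by
  obtain ⟨b0, h0, b1, h1, rfl⟩ := h.exists_add b
  have e0 := h.super_comm 0 0 a b0 ha h0
  have e1 := h.super_comm 0 1 a b1 ha h1
  simp only [zero_mul, sgn_zero, one_smul] at e0 e1
  rw [mul_add, add_mul, e0, e1]

theorem odd_mul_self (h : IsSuperCommAlgebra gr) {a : R} (ha : a ∈ gr 1) : a * a = 0 := by
  have e := h.super_comm 1 1 a a ha ha
  simp only [mul_one, sgn_one, neg_smul, one_smul] at e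
  have : (2 : ℝ) • (a * a) = 0 := by
    rw [two_smul]; nth_rewrite 1 [e]; simp
  simpa using this

/-- The subalgebra of even elements. -/
def evenSub (h : IsSuperCommAlgebra gr) : Subalgebra ℝ R where
  carrier := gr 0
  mul_mem' ha hb := by simpa using h.mul_mem ha hb
  add_mem' ha hb := (gr 0).add_mem ha hb
  algebraMap_mem' r := by
    rw [Algebra.algebraMap_eq_smul_one]
    exact (gr 0).smul_mem r h.one_mem

/-- Makes the commutative theory of determinants, adjugates and nilradicals available for matrices
with even entries. -/
instance (h : IsSuperCommAlgebra gr) : CommRing h.evenSub :=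
  { h.evenSub.toRing with
    mul_comm := fun a b => Subtype.ext (h.even_mul_comm a.2 b.1) }

/-- Inverses of even units are even. -/
theorem inverse_mem (h : IsSuperCommAlgebra gr) {a : R} (ha : a ∈ gr 0) (hu : IsUnit a) :
    Ring.inverse a ∈ gr 0 := by
  obtain ⟨b0, h0, b1, h1, e⟩ := h.exists_add (Ring.inverse a)
  have e1 : a * b0 + a * b1 = 1 := by
    rw [← mul_add, e, Ring.mul_inverse_cancel a hu]
  have m0 : a * b0 ∈ gr 0 := by simpa using h.mul_mem ha h0
  have m1 : a * b1 ∈ gr 1 := by simpa using h.mul_mem ha h1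
  -- The product `a * b1` is odd, but it is also `1 - a * b0`, which is even.
  have hz : a * b1 = 0 := by
    refine h.eq_zero_of_mem (p := 0) ?_ (by simpa using m1)
    rw [← eq_sub_iff_add_eq'] at e1
    rw [e1]
    exact (gr 0).sub_mem h.one_mem m0
  have : b1 = 0 := by simpa using (hu.mul_right_eq_zero).1 hz
  rw [← e, this, add_zero]
  exact h0

end IsSuperCommAlgebra

namespace IsSuperDer

theorem leibniz_even {p : ZMod 2} {D : R →ₗ[ℝ] R} (hD : IsSuperDer gr p D) {f : R} (g : R)
    (hf : f ∈ gr 0) : D (f * g) = D f * g + f * D g := by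
  simpa using hD.leibniz 0 f g hf

theorem map_one {p : ZMod 2} {D : R →ₗ[ℝ] R} (hD : IsSuperDer gr p D)
    (h : IsSuperCommAlgebra gr) : D 1 = 0 := by
  have := hD.leibniz_even 1 h.one_mem
  simpa using this

theorem map_even_inverse {p : ZMod 2} {D : R →ₗ[ℝ] R} (hD : IsSuperDer gr p D)
    (h : IsSuperCommAlgebra gr) {a b : R} (ha : a ∈ gr 0) (hb : b ∈ gr 0) (hab : a * b = 1) :
    D b = - (b * b * D a) := by
  have e := hD.leibniz_even b ha
  rw [hab, hD.map_one h] at e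
  have hba : b * a = 1 := by rw [h.even_mul_comm hb, hab]
  have e2 : b * (D a * b) + D b = 0 := by
    have := congrArg (b * ·) e
    simp only [mul_zero, mul_add, ← mul_assoc b a, hba, one_mul] at this
    exact this.symm
  rw [← h.even_mul_comm hb, ← mul_assoc] at e2
  exact eq_neg_of_add_eq_zero_right e2

theorem sub {p : ZMod 2} {D D' : R →ₗ[ℝ] R} (hD : IsSuperDer gr p D) (hD' : IsSuperDer gr p D') :
    IsSuperDer gr p (D - D') where
  map_parity q f hf := (gr _).sub_mem (hD.map_parity q f hf) (hD'.map_parity q f hf)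
  leibniz q f g hf := by
    simp only [LinearMap.sub_apply, hD.leibniz q f g hf, hD'.leibniz q f g hf, sub_mul, mul_sub,
      smul_sub]
    abel

theorem sum {ι : Type*} (s : Finset ι) {p : ZMod 2} {D : ι → R →ₗ[ℝ] R}
    (hD : ∀ i, IsSuperDer gr p (D i)) : IsSuperDer gr p (∑ i ∈ s, D i) where
  map_parity q f hf := by
    rw [LinearMap.sum_apply]
    exact (gr _).sum_mem fun i _ => (hD i).map_parity q f hf
  leibniz q f g hf := by
    simp only [LinearMap.sum_apply, Finset.sum_mul, Finset.mul_sum, Finset.smul_sum,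
      ← Finset.sum_add_distrib]
    exact Finset.sum_congr rfl fun i _ => (hD i).leibniz q f g hf

/-- Moving `a` past `f` costs exactly the sign by which the parities of `D` and `a ∘ D` differ. The
target parity is a free variable `r` because for `X(x^a) ∂_a` it must come out as the parity of `X`.
-/
theorem mulLeft (h : IsSuperCommAlgebra gr) {p q r : ZMod 2} {D : R →ₗ[ℝ] R}
    (hD : IsSuperDer gr p D) {a : R} (ha : a ∈ gr q) (hr : q + p = r) :
    IsSuperDer gr r (LinearMap.mulLeft ℝ a ∘ₗ D) where
  map_parity s f hf := by
    rw [← hr, add_assoc]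
    exact h.mul_mem ha (hD.map_parity s f hf)
  leibniz s f g hf := by
    subst hr
    simp only [LinearMap.comp_apply, LinearMap.mulLeft_apply, hD.leibniz s f g hf, mul_add,
      mul_assoc, mul_smul_comm]
    rw [← mul_assoc a f, h.super_comm q s a f ha hf, smul_mul_assoc, sgn_smul_smul, mul_assoc]
    congr 3
    ring

end IsSuperDer

/-! ### The derivative of determinants and Berezinians -/

/-- Jacobi's formula. The derivation takes values in a module because an odd superderivation does
not map the even subalgebra to itself. -/
theorem derivation_det {E P : Type*} [CommRing E] [Algebra ℝ E] [AddCommGroup P] [Module E P]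
    [Module ℝ P] (d : Derivation ℝ E P) {k : ℕ} (S : Matrix (Fin k) (Fin k) E) :
    d S.det = ∑ i, ∑ j, S.adjugate i j • d (S j i) := by
  have hprod : ∀ (s : Finset (Fin k)) (f : Fin k → E),
      d (∏ i ∈ s, f i) = ∑ i ∈ s, (∏ j ∈ s.erase i, f j) • d (f i) := by
    intro s f
    induction s using Finset.induction_on with
    | empty => simp
    | insert a s ha ih =>
      rw [Finset.prod_insert ha, d.leibniz, ih, Finset.sum_insert ha, Finset.erase_insert ha,
        add_comm, Finset.smul_sum]
      congr 1
      refine Finset.sum_congr rfl fun i hi => ?_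
      rw [Finset.erase_insert_of_ne (by rintro rfl; exact ha hi),
        Finset.prod_insert (fun hh => ha (Finset.mem_of_mem_erase hh)), smul_smul]
  -- The `(i, j)` cofactor collects the permutations with `σ i = j`, with the factor in column `i`
  -- removed, which is what the product rule leaves.
  have hadj : ∀ i j, S.adjugate i j = ∑ σ : Equiv.Perm (Fin k),
      if σ i = j then ((Equiv.Perm.sign σ : ℤˣ) : ℤ) • ∏ l ∈ Finset.univ.erase i, S (σ l) l
      else 0 := by
    intro i j
    rw [Matrix.adjugate_apply, Matrix.det_apply]
    refine Finset.sum_congr rfl fun σ _ => ?_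
    split_ifs with hσ
    · rw [← Finset.mul_prod_erase _ _ (Finset.mem_univ i), hσ, Matrix.updateRow_self,
        Pi.single_eq_same, one_mul]
      congr 1
      refine Finset.prod_congr rfl fun l hl => ?_
      rw [Matrix.updateRow_ne]
      exact fun hh => (Finset.ne_of_mem_erase hl) (σ.injective (hh.trans hσ.symm))
    · rw [Finset.prod_eq_zero (Finset.mem_univ (σ.symm j)), smul_zero]
      rw [σ.apply_symm_apply, Matrix.updateRow_self, Pi.single_eq_of_ne]
      rintro rfl
      exact hσ (σ.apply_symm_apply j)
  rw [Matrix.det_apply, map_sum]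
  simp only [hadj, Finset.sum_smul]
  rw [Finset.sum_congr rfl fun i _ => Finset.sum_comm, Finset.sum_comm]
  refine Finset.sum_congr rfl fun σ _ => ?_
  rw [Units.smul_def, map_zsmul, hprod, Finset.smul_sum]
  refine Finset.sum_congr rfl fun i _ => ?_
  rw [Finset.sum_eq_single (σ i)]
  · rw [if_pos rfl, smul_assoc]
  · intro j _ hj
    rw [if_neg hj.symm, zero_smul]
  · simp

/-- All entries of the matrix `X` have parity `q`. -/
def MatrixParity {ι κ : Type*} (gr : ZMod 2 → Submodule ℝ R) (q : ZMod 2) (X : Matrix ι κ R) :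
    Prop :=
  ∀ i j, X i j ∈ gr q

theorem MatrixParity.mul (h : IsSuperCommAlgebra gr) {ι κ l : Type*} [Fintype κ] {q r s : ZMod 2}
    {X : Matrix ι κ R} {Y : Matrix κ l R} (hX : MatrixParity gr q X) (hY : MatrixParity gr r Y)
    (hs : q + r = s) : MatrixParity gr s (X * Y) := fun i j => by
  rw [Matrix.mul_apply, ← hs]
  exact (gr _).sum_mem fun k _ => h.mul_mem (hX i k) (hY k j)

theorem MatrixParity.map {ι κ : Type*} {p q r : ZMod 2} {D : R →ₗ[ℝ] R}
    {X : Matrix ι κ R} (hX : MatrixParity gr q X) (hD : IsSuperDer gr p D) (hr : p + q = r) :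
    MatrixParity gr r (X.map D) := fun i j => hr ▸ hD.map_parity q _ (hX i j)

theorem IsSuperDer.map_matrix_mul {ι κ l : Type*} [Fintype κ] {p q : ZMod 2} {D : R →ₗ[ℝ] R}
    (hD : IsSuperDer gr p D) {X : Matrix ι κ R} (Y : Matrix κ l R) (hX : MatrixParity gr q X) :
    (X * Y).map D = X.map D * Y + sgn (p * q) • (X * Y.map D) := by
  ext i j
  simp only [Matrix.map_apply, Matrix.mul_apply, Matrix.add_apply, Matrix.smul_apply, map_sum,
    Finset.smul_sum, ← Finset.sum_add_distrib]
  exact Finset.sum_congr rfl fun k _ => hD.leibniz q _ _ (hX i k)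

theorem MatrixParity.trace_mul_comm (h : IsSuperCommAlgebra gr) {ι κ : Type*} [Fintype ι]
    [Fintype κ] {q r : ZMod 2} {X : Matrix ι κ R} {Y : Matrix κ ι R} (hX : MatrixParity gr q X)
    (hY : MatrixParity gr r Y) : (X * Y).trace = sgn (q * r) • (Y * X).trace := by
  simp only [Matrix.trace, Matrix.diag_apply, Matrix.mul_apply, Finset.smul_sum]
  rw [Finset.sum_comm]
  exact Finset.sum_congr rfl fun k _ => Finset.sum_congr rfl fun i _ =>
    h.super_comm q r _ _ (hX i k) (hY k i)

/-- A matrix with even entries as a matrix over the even subalgebra. -/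
def MatrixParity.lift (h : IsSuperCommAlgebra gr) {ι κ : Type*} {X : Matrix ι κ R}
    (hX : MatrixParity gr 0 X) : Matrix ι κ h.evenSub :=
  Matrix.of fun i j => ⟨X i j, hX i j⟩

theorem leibnizDet_eq (h : IsSuperCommAlgebra gr) {k : ℕ} {X : Matrix (Fin k) (Fin k) R}
    (hX : MatrixParity gr 0 X) : leibnizDet X = ((hX.lift h).det : h.evenSub) := by
  rw [← leibnizDet_eq_det]
  simp only [leibnizDet]
  rw [← Subalgebra.coe_val, map_sum]
  refine Finset.sum_congr rfl fun σ _ => ?_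
  rw [map_zsmul, map_list_prod, List.map_ofFn]
  rfl

theorem leibnizDet_mem (h : IsSuperCommAlgebra gr) {k : ℕ} {X : Matrix (Fin k) (Fin k) R}
    (hX : MatrixParity gr 0 X) : leibnizDet X ∈ gr 0 := by
  rw [leibnizDet_eq h hX]
  exact ((hX.lift h).det : h.evenSub).2

theorem MatrixParity.lift_mul (h : IsSuperCommAlgebra gr) {k : ℕ} {X Y : Matrix (Fin k) (Fin k) R}
    (hX : MatrixParity gr 0 X) (hY : MatrixParity gr 0 Y) (hXY : X * Y = 1) :
    hX.lift h * hY.lift h = 1 := by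
  ext i j
  have := congrFun (congrFun hXY i) j
  rw [Matrix.mul_apply] at this ⊢
  rw [← Subalgebra.coe_val, map_sum]
  simp only [map_mul]
  refine this.trans ?_
  rw [Matrix.one_apply, Matrix.one_apply]
  split_ifs <;> rfl

theorem isUnit_leibnizDet (h : IsSuperCommAlgebra gr) {k : ℕ} {X Y : Matrix (Fin k) (Fin k) R}
    (hX : MatrixParity gr 0 X) (hY : MatrixParity gr 0 Y) (hXY : X * Y = 1) :
    IsUnit (leibnizDet X) := by
  rw [leibnizDet_eq h hX, ← Subalgebra.coe_val]
  refine IsUnit.map h.evenSub.val (IsUnit.of_mul_eq_one (hY.lift h).det ?_)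
  rw [← Matrix.det_mul, hX.lift_mul h hY hXY, Matrix.det_one]

/-- The derivative of the determinant of an invertible matrix with even entries. -/
theorem IsSuperDer.map_leibnizDet (h : IsSuperCommAlgebra gr) {p : ZMod 2} {D : R →ₗ[ℝ] R}
    (hD : IsSuperDer gr p D) {k : ℕ} {X Y : Matrix (Fin k) (Fin k) R}
    (hX : MatrixParity gr 0 X) (hY : MatrixParity gr 0 Y) (hXY : X * Y = 1) :
    D (leibnizDet X) = leibnizDet X * (Y * X.map D).trace := by
  -- On even elements the sign in the Leibniz rule disappears, so `D` restricts to an ordinary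
  -- derivation with values in `R`, whatever its parity.
  let d : Derivation ℝ h.evenSub R :=
    { (D ∘ₗ h.evenSub.val.toLinearMap) with
      map_one_eq_zero' := hD.map_one h
      leibniz' := fun a b => by
        change D (a.1 * b.1) = a.1 * D b.1 + b.1 * D a.1
        rw [hD.leibniz_even _ a.2, h.even_mul_comm b.2, add_comm] }
  have hadj : (hX.lift h).adjugate = (hX.lift h).det • hY.lift h := by
    have e := hX.lift_mul h hY hXY
    calc (hX.lift h).adjugate = (hX.lift h).adjugate * (hX.lift h * hY.lift h) := by rw [e, mul_one]
      _ = _ := by rw [← mul_assoc, Matrix.adjugate_mul, smul_mul_assoc, one_mul]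
  have key := derivation_det d (hX.lift h)
  rw [leibnizDet_eq h hX]
  refine key.trans ?_
  simp only [Matrix.trace, Matrix.diag_apply, Matrix.mul_apply, Finset.mul_sum]
  refine Finset.sum_congr rfl fun i _ => Finset.sum_congr rfl fun j _ => ?_
  rw [hadj, Matrix.smul_apply, smul_assoc]
  rfl

/-- Two odd matrices `C`, `F` have a nilpotent product, so `1 - C * F` has an inverse with even
entries. -/
theorem exists_inverse_one_sub_odd_mul_odd (h : IsSuperCommAlgebra gr) {k l : ℕ}
    {C : Matrix (Fin k) (Fin l) R} {F : Matrix (Fin l) (Fin k) R}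
    (hC : MatrixParity gr 1 C) (hF : MatrixParity gr 1 F) :
    ∃ Y : Matrix (Fin k) (Fin k) R, MatrixParity gr 0 Y ∧ (1 - C * F) * Y = 1 := by
  have hN : MatrixParity gr 0 (C * F) := hC.mul h hF (by decide)
  set N := hN.lift h with hNdef
  have hnil : ∀ i j, N i j ∈ nilradical h.evenSub := by
    intro i j
    have e : N i j = ∑ l, (⟨C i l * F l j, h.mul_mem (hC i l) (hF l j)⟩ :
        h.evenSub) := by
      apply Subtype.ext
      rw [← Subalgebra.coe_val, map_sum]
      exact Matrix.mul_apply (M := C) (N := F)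
    rw [e]
    refine Ideal.sum_mem _ fun l _ => ⟨2, Subtype.ext ?_⟩
    rw [pow_two]
    change C i l * F l j * (C i l * F l j) = 0
    -- In `(CF)(CF)` the middle pair is swapped, which brings the two equal odd factors `F l j`
    -- together.
    have e2 := h.super_comm 1 1 _ _ (hF l j) (hC i l)
    rw [mul_assoc, ← mul_assoc (F l j), e2, smul_mul_assoc, mul_smul_comm, mul_assoc (C i l),
      h.odd_mul_self (hF l j)]
    simp
  have hunit : IsUnit (1 - N).det := by
    -- Modulo the nilradical `1 - N` is the identity matrix.
    have hm : (1 - N).det - 1 ∈ nilradical h.evenSub := by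
      rw [← Ideal.Quotient.eq, map_one, RingHom.map_det]
      have : (Ideal.Quotient.mk (nilradical h.evenSub)).mapMatrix (1 - N) = 1 := by
        rw [map_sub, map_one, sub_eq_self]
        ext i j
        exact Ideal.Quotient.eq_zero_iff_mem.2 (hnil i j)
      rw [this, Matrix.det_one]
    have := (mem_nilradical.1 hm).isUnit_one_add
    simpa using this
  refine ⟨((1 - N)⁻¹).map h.evenSub.val, fun i j => ((1 - N)⁻¹ i j).2, ?_⟩
  have e1 : (1 - C * F) = (1 - N).map h.evenSub.val := by
    rw [Matrix.map_sub _ (map_sub h.evenSub.val), Matrix.map_one _ (map_zero _) (map_one _)]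
    rfl
  rw [e1, ← Matrix.map_mul, Matrix.mul_nonsing_inv _ hunit,
    Matrix.map_one _ (map_zero _) (map_one _)]

theorem MatrixParity.mul_eq_one_comm (h : IsSuperCommAlgebra gr) {k : ℕ}
    {X Y : Matrix (Fin k) (Fin k) R} (hX : MatrixParity gr 0 X) (hY : MatrixParity gr 0 Y)
    (hXY : X * Y = 1) : Y * X = 1 := by
  have e := _root_.mul_eq_one_comm.1 (hX.lift_mul h hY hXY)
  have := congrArg (fun Z => Matrix.map Z h.evenSub.val) e
  simp only [Matrix.map_mul, Matrix.map_one _ (map_zero h.evenSub.val) (map_one _)] at this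
  exact this

theorem ring_inverse_eq {S : Type*} [Ring S] {a b : S} (hab : a * b = 1) (hba : b * a = 1) :
    Ring.inverse a = b :=
  Ring.inverse_unit (⟨a, b, hab, hba⟩ : Sˣ)

theorem isUnit_ring_inverse {S : Type*} [Ring S] {a : S} (ha : IsUnit a) :
    IsUnit (Ring.inverse a) := by
  obtain ⟨u, rfl⟩ := ha
  rw [Ring.inverse_unit]
  exact Units.isUnit _

/-- The logarithmic derivative of the Berezinian, in terms of the blocks of the supermatrix and of
its inverse. -/
theorem berezinian_blocks (h : IsSuperCommAlgebra gr) {n m : ℕ}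
    {A a : Matrix (Fin n) (Fin n) R} {B b : Matrix (Fin n) (Fin m) R}
    {C c : Matrix (Fin m) (Fin n) R} {D d : Matrix (Fin m) (Fin m) R}
    (hA : MatrixParity gr 0 A) (hB : MatrixParity gr 1 B) (hC : MatrixParity gr 1 C)
    (hD : MatrixParity gr 0 D) (ha : MatrixParity gr 0 a) (hb : MatrixParity gr 1 b)
    (hd : MatrixParity gr 0 d)
    (h11 : A * a + B * c = 1) (h21 : C * a + D * c = 0) (h22 : C * b + D * d = 1)
    (k12 : a * B + b * D = 0) :
    berezinian (Matrix.fromBlocks A B C D) ∈ gr 0 ∧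
    IsUnit (berezinian (Matrix.fromBlocks A B C D)) ∧
    ∀ (p : ZMod 2) (δ : R →ₗ[ℝ] R), IsSuperDer gr p δ →
      δ (berezinian (Matrix.fromBlocks A B C D)) = berezinian (Matrix.fromBlocks A B C D) *
        ((a * A.map δ).trace + sgn p • (b * C.map δ).trace
          - sgn p • (c * B.map δ).trace - (d * D.map δ).trace) := by
  -- Invertibility of the block `D` is not assumed. It follows from `D d = 1 - C b`, where `C b` is
  -- a product of odd matrices, and `E = d Y` is the inverse.
  obtain ⟨Y, hY, hY1⟩ := exists_inverse_one_sub_odd_mul_odd h hC hb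
  have hDd : D * d = 1 - C * b := eq_sub_of_add_eq' h22
  set E := d * Y with hEdef
  have hE : MatrixParity gr 0 E := hd.mul h hY (by decide)
  have hDE : D * E = 1 := by rw [hEdef, ← Matrix.mul_assoc, hDd, hY1]
  have hED : E * D = 1 := hD.mul_eq_one_comm h hE hDE
  have hc : c = -(E * C * a) := by
    have := congrArg (E * ·) h21
    simp only [Matrix.mul_add, ← Matrix.mul_assoc, hED, Matrix.one_mul, Matrix.mul_zero] at this
    exact eq_neg_of_add_eq_zero_right this
  have hb' : b = -(a * B * E) := by
    have := congrArg (· * E) k12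
    simp only [Matrix.add_mul, Matrix.mul_assoc, hDE, Matrix.mul_one, Matrix.zero_mul] at this
    rw [← Matrix.mul_assoc] at this
    exact eq_neg_of_add_eq_zero_right this
  have hd' : d = E + E * C * a * B * E := by
    have := congrArg (E * ·) hDd
    simp only [← Matrix.mul_assoc, hED, Matrix.one_mul] at this
    rw [this, hb']
    simp only [Matrix.mul_add, Matrix.mul_neg, Matrix.mul_one, Matrix.mul_assoc, sub_neg_eq_add]
  -- The Schur complement; its inverse is the block `a` of the inverse supermatrix.
  set S := A - B * E * C with hSdef
  have hBEC : MatrixParity gr 0 (B * E * C) :=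
    (hB.mul h hE (add_zero 1)).mul h hC (by decide)
  have hS : MatrixParity gr 0 S := fun i j => (gr 0).sub_mem (hA i j) (hBEC i j)
  have hSa : S * a = 1 := by
    rw [hSdef, Matrix.sub_mul, ← h11, hc]
    simp only [Matrix.mul_neg, Matrix.mul_assoc, sub_eq_add_neg]
  have hber : berezinian (Matrix.fromBlocks A B C D) =
      leibnizDet S * Ring.inverse (leibnizDet D) := by
    rw [berezinian, Matrix.toBlocks_fromBlocks₁₁, Matrix.toBlocks_fromBlocks₁₂,
      Matrix.toBlocks_fromBlocks₂₁, Matrix.toBlocks_fromBlocks₂₂, ring_inverse_eq hDE hED]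
  have uS := isUnit_leibnizDet h hS ha hSa
  have uD := isUnit_leibnizDet h hD hE hDE
  have mS := leibnizDet_mem h hS
  have mD := leibnizDet_mem h hD
  have mD' := h.inverse_mem mD uD
  rw [hber]
  refine ⟨by simpa using h.mul_mem mS mD', uS.mul (isUnit_ring_inverse uD), fun p δ hδ => ?_⟩
  -- Jacobi's formula for both factors. It remains to rewrite `tr(a δS) - tr(E δD)` through the
  -- blocks `a`, `b`, `c`, `d`.
  have e1 : δ (leibnizDet S * Ring.inverse (leibnizDet D)) =
      leibnizDet S * Ring.inverse (leibnizDet D) *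
        ((a * S.map δ).trace - (E * D.map δ).trace) := by
    rw [hδ.leibniz_even _ mS, hδ.map_leibnizDet h hS ha hSa,
      hδ.map_even_inverse h mD mD' (Ring.mul_inverse_cancel _ uD),
      hδ.map_leibnizDet h hD hE hDE, mul_sub, mul_assoc, ← h.even_mul_comm mD', mul_assoc,
      sub_eq_add_neg, mul_neg]
    simp only [mul_assoc, Ring.inverse_mul_cancel_left _ _ uD]
  rw [e1]
  congr 1
  have hEder : E.map δ = -(E * D.map δ * E) := by
    have := hδ.map_matrix_mul E hD
    rw [hDE, mul_zero, sgn_zero, one_smul] at this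
    have h1 : (1 : Matrix (Fin m) (Fin m) R).map δ = 0 := by
      ext i j
      rw [Matrix.map_apply, Matrix.one_apply]
      split_ifs
      · exact hδ.map_one h
      · exact map_zero δ
    rw [h1] at this
    have := congrArg (E * ·) this
    simp only [Matrix.mul_add, ← Matrix.mul_assoc, hED, Matrix.one_mul, Matrix.mul_zero] at this
    exact eq_neg_of_add_eq_zero_right this.symm
  have hSder : S.map δ = A.map δ - B.map δ * (E * C) + sgn p • (B * E * D.map δ * (E * C))
      - sgn p • (B * E * C.map δ) := by
    rw [hSdef, Matrix.map_sub _ (map_sub δ), Matrix.mul_assoc, hδ.map_matrix_mul _ hB,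
      hδ.map_matrix_mul _ hE, hEder, mul_one, mul_zero, sgn_zero, one_smul]
    simp only [Matrix.mul_add, Matrix.neg_mul, Matrix.mul_neg, smul_add, smul_neg,
      Matrix.mul_assoc]
    abel
  have hEC : MatrixParity gr 1 (E * C) := hE.mul h hC (zero_add 1)
  have haB : MatrixParity gr 1 (a * B * E) :=
    (ha.mul h hB (zero_add 1)).mul h hE (add_zero 1)
  -- Cyclicity carries the odd factor `E C` to the front, past a matrix of parity `p + 1`. This
  -- produces `c = -E C a` in the first trace and the correction `E C a B E` in `d` in the second.
  have t1 := MatrixParity.trace_mul_comm h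
    (ha.mul h (hB.map hδ rfl) (zero_add (p + 1))) hEC
  have t2 := MatrixParity.trace_mul_comm h
    (haB.mul h (hD.map hδ rfl) (r := p + 0) (s := p + 1) (by ring)) hEC
  have hs : sgn ((p + 1) * 1) = - sgn p := by rw [mul_one, sgn_add, sgn_one, mul_neg_one]
  rw [hs] at t1 t2
  rw [hSder, hc, hb', hd']
  simp only [Matrix.mul_add, Matrix.mul_sub, Matrix.add_mul, Matrix.trace_add, Matrix.trace_sub,
    Matrix.neg_mul, Matrix.trace_neg, Matrix.mul_smul, Matrix.trace_smul, smul_neg]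
  simp only [← Matrix.mul_assoc] at t1 t2 ⊢
  rw [t1, t2, smul_smul, mul_neg, sgn_mul_self]
  simp only [neg_smul, one_smul]
  abel

/-- The logarithmic derivative of the Berezinian of an invertible even supermatrix. -/
theorem berezinian_logDeriv (h : IsSuperCommAlgebra gr) {n m : ℕ}
    {J K : Matrix (Fin n ⊕ Fin m) (Fin n ⊕ Fin m) R}
    (hJ : ∀ a b, J a b ∈ gr (idxParity a + idxParity b))
    (hK : ∀ a b, K a b ∈ gr (idxParity a + idxParity b)) (hJK : J * K = 1) (hKJ : K * J = 1) :
    berezinian J ∈ gr 0 ∧ IsUnit (berezinian J) ∧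
    ∀ (p : ZMod 2) (δ : R →ₗ[ℝ] R), IsSuperDer gr p δ →
      δ (berezinian J) = berezinian J *
        ∑ b, ∑ e, sgn (idxParity b + p * (idxParity b + idxParity e)) • (K b e * δ (J e b)) := by
  have e1 := hJK
  have e2 := hKJ
  rw [← Matrix.fromBlocks_toBlocks J, ← Matrix.fromBlocks_toBlocks K, Matrix.fromBlocks_multiply,
    ← Matrix.fromBlocks_one, Matrix.fromBlocks_inj] at e1 e2
  obtain ⟨h11, -, h21, h22⟩ := e1
  obtain ⟨-, k12, -, -⟩ := e2
  have key := berezinian_blocks h (A := J.toBlocks₁₁) (B := J.toBlocks₁₂) (C := J.toBlocks₂₁)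
    (D := J.toBlocks₂₂) (a := K.toBlocks₁₁) (b := K.toBlocks₁₂) (c := K.toBlocks₂₁)
    (d := K.toBlocks₂₂) (fun i j => hJ (.inl i) (.inl j)) (fun i j => hJ (.inl i) (.inr j))
    (fun i j => hJ (.inr i) (.inl j)) (fun i j => hJ (.inr i) (.inr j))
    (fun i j => hK (.inl i) (.inl j)) (fun i j => hK (.inl i) (.inr j))
    (fun i j => hK (.inr i) (.inr j)) h11 h21 h22 k12
  rw [Matrix.fromBlocks_toBlocks] at key
  refine ⟨key.1, key.2.1, fun p δ hδ => ?_⟩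
  rw [key.2.2 p δ hδ]
  congr 1
  simp only [Fintype.sum_sum_type, Matrix.trace, Matrix.diag_apply, Matrix.mul_apply,
    Matrix.map_apply, Matrix.toBlocks₁₁, Matrix.toBlocks₁₂, Matrix.toBlocks₂₁, Matrix.toBlocks₂₂,
    Matrix.of_apply, idxParity, Finset.sum_add_distrib, Finset.smul_sum, add_zero, zero_add,
    mul_zero, mul_one, sgn_zero, one_smul, CharTwo.add_self_eq_zero, sgn_one, sgn_add, neg_smul,
    neg_mul, one_mul, Finset.sum_neg_distrib]
  abel

end Algebra

/-! ### The divergence in supercoordinates and its change of coordinates -/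

section Coordinates

variable {R : Type*} [Ring R] [Algebra ℝ R] {gr : ZMod 2 → Submodule ℝ R}

/-- Supercoordinates `x a` of parities `par a`, with their partial derivatives `D a`. -/
structure SuperCoords {ι : Type*} [DecidableEq ι] (gr : ZMod 2 → Submodule ℝ R) (par : ι → ZMod 2)
    (x : ι → R) (D : ι → R →ₗ[ℝ] R) : Prop where
  mem : ∀ a, x a ∈ gr (par a)
  der : ∀ a, IsSuperDer gr (par a) (D a)
  map_coord : ∀ a b, D a (x b) = if a = b then 1 else 0
  comm : ∀ a b f, D a (D b f) = sgn (par a * par b) • D b (D a f)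

/-- The coordinate expression `∑_a (-1)^{ã(p+1)} D_a (X(x_a))` of the divergence. -/
def coordDiv {ι : Type*} [Fintype ι] (par : ι → ZMod 2) (x : ι → R) (D : ι → R →ₗ[ℝ] R)
    (p : ZMod 2) (X : R →ₗ[ℝ] R) : R :=
  ∑ a, sgn (par a * (p + 1)) • D a (X (x a))

/-- `X` is determined by its values on the coordinates. -/
def Expands {ι : Type*} [Fintype ι] (x : ι → R) (D : ι → R →ₗ[ℝ] R) (X : R →ₗ[ℝ] R) : Prop :=
  ∀ f, X f = ∑ a, X (x a) * D a f

variable {ι : Type*} [Fintype ι] [DecidableEq ι] {par : ι → ZMod 2} {x x' : ι → R}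
  {D D' : ι → R →ₗ[ℝ] R} {p q : ZMod 2} {X Y : R →ₗ[ℝ] R}

/-- The sign in the definition of the divergence is the one that `∂_a` acquires in passing `X(x^a)`,
so the terms in which `s` is differentiated add up to `X s` without signs. -/
theorem SuperCoords.lie_eq (c : SuperCoords gr par x D)
    (hX : IsSuperDer gr p X) (eX : Expands x D X) (s : R) :
    ∑ a, sgn (par a * (p + 1)) • D a (X (x a) * s) = coordDiv par x D p X * s + X s := by
  rw [coordDiv, Finset.sum_mul, eX s, ← Finset.sum_add_distrib]
  refine Finset.sum_congr rfl fun a _ => ?_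
  rw [(c.der a).leibniz _ _ s (hX.map_parity _ _ (c.mem a)), smul_add, sgn_smul_smul,
    smul_mul_assoc]
  have : par a * (p + 1) + par a * (p + par a) = 0 := by
    generalize par a = a; clear * -; revert a p; decide
  rw [this, sgn_zero, one_smul]

/-- Expand `X x'_b = ∑ X(x_a) D_a x'_b` and apply `D'_b`. Terms differentiating `X(x_a)` recombine
into `D_a` by the chain rule; the others contain second derivatives of `x'` and will match the
logarithmic derivative of the Berezinian. -/
theorem SuperCoords.coordDiv_change (h : IsSuperCommAlgebra gr) (c : SuperCoords gr par x D)
    (c' : SuperCoords gr par x' D') (hX : IsSuperDer gr p X)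
    (eX : Expands x D X) (e : ∀ a, Expands x' D' (D a)) (e' : ∀ a, Expands x D (D' a)) :
    coordDiv par x' D' p X = coordDiv par x D p X + ∑ a, X (x a) *
      ∑ b, ∑ l, sgn (par b + par a * (par b + par l)) • (D' b (x l) * D a (D l (x' b))) := by
  have key : ∀ b, sgn (par b * (p + 1)) • D' b (X (x' b)) =
      ∑ a, (sgn (par a * (p + 1)) • (D a (x' b) * D' b (X (x a))) +
        X (x a) * ∑ l, sgn (par b + par a * (par b + par l)) •
          (D' b (x l) * D a (D l (x' b)))) := by
    intro b
    rw [eX (x' b), map_sum, Finset.smul_sum]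
    refine Finset.sum_congr rfl fun a _ => ?_
    have hXa := hX.map_parity _ _ (c.mem a)
    have hJ := (c.der a).map_parity _ _ (c'.mem b)
    rw [(c'.der b).leibniz _ _ _ hXa, smul_add]
    congr 1
    · rw [h.super_comm _ _ _ _ ((c'.der b).map_parity _ _ hXa) hJ, sgn_smul_smul]
      congr 2
      generalize par a = a, par b = b
      clear * -; revert a b p; decide
    -- `D'_b` is expanded in the `D_l`, and `D_l`, `D_a` are exchanged so that `D_a` acts on the
    -- Jacobi matrix entry `D_l x'_b`.
    · rw [sgn_smul_smul, e' b (D a (x' b)), Finset.mul_sum, Finset.smul_sum, Finset.mul_sum]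
      refine Finset.sum_congr rfl fun l _ => ?_
      rw [c.comm l a, mul_smul_comm, mul_smul_comm, sgn_smul_smul, mul_smul_comm]
      congr 2
      generalize par a = a, par b = b, par l = l
      clear * -; revert a b l p; decide
  rw [coordDiv, Finset.sum_congr rfl fun b _ => key b, Finset.sum_comm, coordDiv,
    ← Finset.sum_add_distrib]
  refine Finset.sum_congr rfl fun a _ => ?_
  rw [Finset.sum_add_distrib, ← Finset.smul_sum, ← e a, Finset.mul_sum]

/-- The coordinate expression of the Lie derivative of a Berezin form transforms as a Berezin
form. -/
theorem lie_change {n m : ℕ} (h : IsSuperCommAlgebra gr) {x x' : Fin n ⊕ Fin m → R}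
    {D D' : Fin n ⊕ Fin m → R →ₗ[ℝ] R} (c : SuperCoords gr idxParity x D)
    (c' : SuperCoords gr idxParity x' D') (hX : IsSuperDer gr p X)
    (eX : Expands x D X) (eX' : Expands x' D' X)
    (e : ∀ a, Expands x' D' (D a)) (e' : ∀ a, Expands x D (D' a)) (s : R) :
    ∑ a, sgn (idxParity a * (p + 1)) •
        D a (X (x a) * (berezinian (Matrix.of fun a b => D a (x' b)) * s)) =
      berezinian (Matrix.of fun a b => D a (x' b)) *
        ∑ a, sgn (idxParity a * (p + 1)) • D' a (X (x' a) * s) := by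
  -- The chain rule: the product is `D_a x_b` with `D_a` expanded in the primed coordinates.
  have hJK : (Matrix.of fun a b => D a (x' b)) * (Matrix.of fun a b => D' a (x b)) = 1 := by
    ext a b
    simp only [Matrix.mul_apply, Matrix.of_apply, Matrix.one_apply]
    rw [← e a, c.map_coord]
  have hKJ : (Matrix.of fun a b => D' a (x b)) * (Matrix.of fun a b => D a (x' b)) = 1 := by
    ext a b
    simp only [Matrix.mul_apply, Matrix.of_apply, Matrix.one_apply]
    rw [← e' a, c'.map_coord]
  obtain ⟨hev, -, hder⟩ := berezinian_logDeriv h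
    (J := Matrix.of fun a b => D a (x' b)) (K := Matrix.of fun a b => D' a (x b))
    (fun a b => (c.der a).map_parity _ _ (c'.mem b))
    (fun a b => (c'.der a).map_parity _ _ (c.mem b)) hJK hKJ
  set B := berezinian (Matrix.of fun a b => D a (x' b))
  rw [c.lie_eq hX eX, c'.lie_eq hX eX', hX.leibniz_even _ hev,
    c.coordDiv_change h c' hX eX e e']
  -- The logarithmic derivative of the Berezinian along `X` is exactly the correction term in
  -- `coordDiv_change`.
  have hXB : X B = B * ∑ a, X (x a) * ∑ b, ∑ l,
      sgn (idxParity b + idxParity a * (idxParity b + idxParity l)) •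
        (D' b (x l) * D a (D l (x' b))) := by
    rw [eX B, Finset.mul_sum]
    refine Finset.sum_congr rfl fun a _ => ?_
    rw [hder _ _ (c.der a), ← mul_assoc, ← h.even_mul_comm hev, mul_assoc]
    rfl
  rw [hXB, mul_add, ← mul_assoc B, mul_add, add_mul, h.even_mul_comm hev (coordDiv _ _ _ _ _)]
  simp only [mul_assoc]
  abel

/-- The divergence of supercommuting vector fields `X`, `Y` satisfies
`X (div Y) = (-1)^{pq} Y (div X)`. -/
theorem SuperCoords.apply_coordDiv (h : IsSuperCommAlgebra gr) (c : SuperCoords gr par x D)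
    (hX : IsSuperDer gr p X) (hY : IsSuperDer gr q Y) (eX : Expands x D X) (eY : Expands x D Y)
    (hXY : ∀ f, X (Y f) = sgn (p * q) • Y (X f)) :
    X (coordDiv par x D q Y) = sgn (p * q) • Y (coordDiv par x D p X) := by
  -- Commuting `X` past `D_a` leaves only `D_a(X x_b) D_b(Y x_a)`: the second derivatives of `Y x_a`
  -- cancel because partial derivatives supercommute.
  have key : ∀ {p q : ZMod 2} {X Y : R →ₗ[ℝ] R}, IsSuperDer gr p X → Expands x D X →
      X (coordDiv par x D q Y) = ∑ a, sgn (par a * (p + q + 1)) • D a (X (Y (x a))) -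
        ∑ a, ∑ b, sgn (par a * (p + q + 1)) • (D a (X (x b)) * D b (Y (x a))) := by
    intro p q X Y hX eX
    rw [coordDiv, map_sum, ← Finset.sum_sub_distrib]
    refine Finset.sum_congr rfl fun a _ => ?_
    rw [map_smul, eX (Y (x a)), eX (D a _), map_sum, Finset.smul_sum, Finset.smul_sum,
      ← Finset.sum_sub_distrib]
    refine Finset.sum_congr rfl fun b _ => ?_
    rw [(c.der a).leibniz _ _ _ (hX.map_parity _ _ (c.mem b)), smul_add, add_sub_cancel_left,
      sgn_smul_smul, c.comm b a, mul_smul_comm, sgn_smul_smul]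
    congr 2
    generalize par a = a, par b = b
    clear * -; revert a b p q; decide
  rw [key hX eX, key hY eY, smul_sub]
  congr 1
  · rw [Finset.smul_sum]
    refine Finset.sum_congr rfl fun a _ => ?_
    rw [hXY, map_smul, smul_comm, add_comm p q]
  -- Exchanging the indices and then the two factors identifies the double sums for `(X, Y)` and
  -- `(Y, X)`.
  · rw [Finset.sum_comm, Finset.smul_sum]
    refine Finset.sum_congr rfl fun b _ => ?_
    rw [Finset.smul_sum]
    refine Finset.sum_congr rfl fun a _ => ?_
    rw [h.super_comm _ _ _ _ ((c.der a).map_parity _ _ (hX.map_parity _ _ (c.mem b)))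
      ((c.der b).map_parity _ _ (hY.map_parity _ _ (c.mem a))), sgn_smul_smul, sgn_smul_smul]
    congr 2
    generalize par a = a, par b = b
    clear * -; revert a b p q; decide

/-- The divergences `f`, `g`, with respect to the density `s`, of supercommuting vector fields `X`,
`Y` satisfy `X g = (-1)^{pq} Y f`. -/
theorem SuperCoords.apply_divergence (h : IsSuperCommAlgebra gr) (c : SuperCoords gr par x D)
    (hX : IsSuperDer gr p X) (hY : IsSuperDer gr q Y) (eX : Expands x D X) (eY : Expands x D Y)
    (hXY : ∀ f, X (Y f) = sgn (p * q) • Y (X f)) {s f g : R} (hs : s ∈ gr 0) (us : IsUnit s)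
    (hf : s * f = ∑ a, sgn (par a * (p + 1)) • D a (X (x a) * s))
    (hg : s * g = ∑ a, sgn (par a * (q + 1)) • D a (Y (x a) * s)) :
    X g = sgn (p * q) • Y f := by
  have hs' := h.inverse_mem hs us
  set t := Ring.inverse s
  have hts : s * t = 1 := Ring.mul_inverse_cancel s us
  have hts' : t * s = 1 := Ring.inverse_mul_cancel s us
  have ef : f = coordDiv par x D p X + t * X s := by
    rw [c.lie_eq hX eX, ← h.even_mul_comm hs] at hf
    rw [← one_mul f, ← hts', mul_assoc, hf, mul_add, ← mul_assoc, hts', one_mul]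
  have eg : g = coordDiv par x D q Y + t * Y s := by
    rw [c.lie_eq hY eY, ← h.even_mul_comm hs] at hg
    rw [← one_mul g, ← hts', mul_assoc, hg, mul_add, ← mul_assoc, hts', one_mul]
  have mX := hX.map_parity 0 s hs
  have mY := hY.map_parity 0 s hs
  rw [add_zero] at mX mY
  -- For the density terms, `X(t Y s) = -t² (X s)(Y s) + t X(Y s)`, and both summands are
  -- supersymmetric in `X`, `Y`.
  rw [ef, eg, map_add, map_add, c.apply_coordDiv h hX hY eX eY hXY, hX.leibniz_even _ hs',
    hY.leibniz_even _ hs', hX.map_even_inverse h hs hs' hts, hY.map_even_inverse h hs hs' hts,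
    hXY s, smul_add, smul_add, mul_smul_comm, neg_mul, neg_mul, mul_assoc _ (X s),
    h.super_comm _ _ _ _ mX mY, mul_smul_comm, smul_neg, mul_assoc _ (Y s)]

end Coordinates

theorem zmod_two_cases (q : ZMod 2) : q = 0 ∨ q = 1 := by
  revert q; decide

/-! ### The partial derivatives of the model -/

section Model

variable {n m : ℕ} {W : Opens (Rn n)}

/-- The extension by zero of a function on `W`. -/
noncomputable def extendFun (f : smoothFun W) : Rn n → ℝ := Function.extend Subtype.val f.1 0

theorem extendFun_apply (f : smoothFun W) (x : W) : extendFun f x = f.1 x :=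
  Subtype.val_injective.extend_apply _ _ _

theorem contDiffAt_extendFun (f : smoothFun W) (x : W) : ContDiffAt ℝ ∞ (extendFun f) x :=
  ContDiffOn.contDiffAt (s := (W : Set (Rn n))) f.2 (W.isOpen.mem_nhds x.2)

theorem differentiableAt_extendFun (f : smoothFun W) (x : W) :
    DifferentiableAt ℝ (extendFun f) x :=
  (contDiffAt_extendFun f x).differentiableAt (by simp)

/-- The derivative at a point of the open set `W` sees only values on `W`, so any convenient `F` may
replace the extension by zero. -/
theorem smoothPartial_apply {f : smoothFun W} {F : Rn n → ℝ} (hF : ∀ x : W, F x = f.1 x)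
    (μ : Fin n) (x : W) :
    (smoothPartial W μ f).1 x = fderiv ℝ F x (EuclideanSpace.single μ (1 : ℝ)) := by
  have : Function.extend Subtype.val f.1 0 =ᶠ[nhds (x : Rn n)] F := by
    filter_upwards [W.isOpen.mem_nhds x.2] with y hy
    rw [hF ⟨y, hy⟩]
    exact extendFun_apply f ⟨y, hy⟩
  change fderiv ℝ (Function.extend Subtype.val f.1 0) x _ = _
  rw [this.fderiv_eq]

theorem smoothPartial_mul (μ : Fin n) (f g : smoothFun W) :
    smoothPartial W μ (f * g) = smoothPartial W μ f * g + f * smoothPartial W μ g := by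
  ext x
  have e := smoothPartial_apply (f := f * g) (F := extendFun f * extendFun g)
    (fun x => by simp [extendFun_apply]) μ x
  rw [fderiv_mul (differentiableAt_extendFun f x) (differentiableAt_extendFun g x)] at e
  refine e.trans ?_
  change _ = (smoothPartial W μ f).1 x * g.1 x + f.1 x * (smoothPartial W μ g).1 x
  rw [smoothPartial_apply (extendFun_apply f), smoothPartial_apply (extendFun_apply g)]
  simp [extendFun_apply]
  ring

theorem smoothPartial_comm (μ ν : Fin n) (f : smoothFun W) :
    smoothPartial W μ (smoothPartial W ν f) = smoothPartial W ν (smoothPartial W μ f) := by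
  ext x
  have key : ∀ μ ν : Fin n, (smoothPartial W μ (smoothPartial W ν f)).1 x =
      fderiv ℝ (fderiv ℝ (extendFun f)) x (EuclideanSpace.single μ (1 : ℝ))
        (EuclideanSpace.single ν (1 : ℝ)) := by
    intro μ ν
    rw [smoothPartial_apply (F := fun y => fderiv ℝ (extendFun f) y
      (EuclideanSpace.single ν (1 : ℝ)))
      (fun y => (smoothPartial_apply (extendFun_apply f) ν y).symm)]
    have hd : DifferentiableAt ℝ (fderiv ℝ (extendFun f)) x :=
      ((contDiffAt_extendFun f x).fderiv_right (m := 1) (by norm_cast)).differentiableAt (by simp)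
    rw [fderiv_clm_apply hd (differentiableAt_const _)]
    simp
  rw [key, key]
  exact (contDiffAt_extendFun f x).isSymmSndFDerivAt
    (by
        rw [minSmoothness_of_isRCLikeNormedField]
        exact WithTop.coe_le_coe.2 (le_top : (2 : ℕ∞) ≤ ⊤)) _ _

theorem smoothPartial_coord (μ ν : Fin n) :
    smoothPartial W μ (smoothCoord W ν) = if μ = ν then 1 else 0 := by
  ext x
  rw [smoothPartial_apply (F := fun y => EuclideanSpace.proj (𝕜 := ℝ) ν y) (fun _ => rfl),
    ContinuousLinearMap.fderiv]
  split_ifs with h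
  · simp [h]
  · simp [Ne.symm h]

theorem smoothPartial_res {W' : Opens (Rn n)} (h : W' ≤ W) (μ : Fin n) (f : smoothFun W) :
    smoothPartial W' μ (smoothRes h f) = smoothRes h (smoothPartial W μ f) := by
  ext x
  rw [smoothPartial_apply (f := smoothRes h f) (F := extendFun f)
    (fun y => extendFun_apply f ⟨y.1, h y.2⟩)]
  exact (smoothPartial_apply (extendFun_apply f) μ ⟨x.1, h x.2⟩).symm

/-- The even and odd parts of the Grassmann algebra. -/
abbrev grassmannParity (m : ℕ) (p : ZMod 2) : Submodule ℝ (Grassmann m) :=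
  CliffordAlgebra.evenOdd (0 : QuadraticForm ℝ (Fin m → ℝ)) p

/-- Contraction is an antiderivation twisted by the grade involution, by induction on generators; on
homogeneous elements the involution is the sign. -/
theorem contract_mul (d : Module.Dual ℝ (Fin m → ℝ)) {q : ZMod 2} {x : Grassmann m}
    (hx : x ∈ grassmannParity m q) (y : Grassmann m) :
    CliffordAlgebra.contractLeft (Q := (0 : QuadraticForm ℝ (Fin m → ℝ))) d (x * y) =
      CliffordAlgebra.contractLeft (Q := (0 : QuadraticForm ℝ (Fin m → ℝ))) d x * y +
      sgn q • (x * CliffordAlgebra.contractLeft (Q := (0 : QuadraticForm ℝ (Fin m → ℝ))) d y) := by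
  have key : ∀ x : CliffordAlgebra (0 : QuadraticForm ℝ (Fin m → ℝ)),
      CliffordAlgebra.contractLeft d (x * y) = CliffordAlgebra.contractLeft d x * y +
        CliffordAlgebra.involute x * CliffordAlgebra.contractLeft d y := by
    intro x
    induction x using CliffordAlgebra.left_induction with
    | algebraMap r => simp [CliffordAlgebra.contractLeft_algebraMap_mul]
    | add x y hx hy => simp only [add_mul, map_add, hx, hy]; abel
    | ι_mul x v hx =>
      rw [mul_assoc, CliffordAlgebra.contractLeft_ι_mul, CliffordAlgebra.contractLeft_ι_mul, hx,
        map_mul, CliffordAlgebra.involute_ι, sub_mul, mul_add, smul_mul_assoc]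
      simp only [neg_mul, mul_assoc]
      abel
  refine (key x).trans ?_
  congr 1
  rcases zmod_two_cases q with rfl | rfl
  · rw [CliffordAlgebra.involute_eq_of_mem_even hx, sgn_zero, one_smul]
  · rw [CliffordAlgebra.involute_eq_of_mem_odd hx, sgn_one, neg_smul, one_smul, neg_mul]

/-- Even and odd elements are built by multiplying with pairs of vectors; each term of the
contraction of `v w x` either loses one vector or contracts `x`. -/
theorem contract_mem (d : Module.Dual ℝ (Fin m → ℝ)) (q : ZMod 2) {x : Grassmann m}
    (hx : x ∈ grassmannParity m q) :
    CliffordAlgebra.contractLeft (Q := (0 : QuadraticForm ℝ (Fin m → ℝ))) d x ∈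
      grassmannParity m (1 + q) := by
  have step : ∀ (q : ZMod 2) (v w : Fin m → ℝ)
      (x : CliffordAlgebra (0 : QuadraticForm ℝ (Fin m → ℝ))),
      x ∈ CliffordAlgebra.evenOdd (0 : QuadraticForm ℝ (Fin m → ℝ)) q →
      CliffordAlgebra.contractLeft d x ∈
        CliffordAlgebra.evenOdd (0 : QuadraticForm ℝ (Fin m → ℝ)) (1 + q) →
      CliffordAlgebra.contractLeft d (CliffordAlgebra.ι _ v * CliffordAlgebra.ι _ w * x) ∈
        CliffordAlgebra.evenOdd (0 : QuadraticForm ℝ (Fin m → ℝ)) (1 + q) := by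
    intro q v w x hx ih
    have hι := CliffordAlgebra.ι_mem_evenOdd_one (0 : QuadraticForm ℝ (Fin m → ℝ))
    rw [mul_assoc, CliffordAlgebra.contractLeft_ι_mul, CliffordAlgebra.contractLeft_ι_mul]
    refine Submodule.sub_mem _ (Submodule.smul_mem _ _ (SetLike.mul_mem_graded (hι w) hx)) ?_
    rw [mul_sub, mul_smul_comm]
    refine Submodule.sub_mem _ (Submodule.smul_mem _ _ (SetLike.mul_mem_graded (hι v) hx)) ?_
    have := SetLike.mul_mem_graded (hι v) (SetLike.mul_mem_graded (hι w) ih)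
    rwa [← add_assoc, CharTwo.add_self_eq_zero, zero_add] at this
  rcases zmod_two_cases q with rfl | rfl
  · refine CliffordAlgebra.even_induction _ (motive := fun x _ => CliffordAlgebra.contractLeft d x ∈
      CliffordAlgebra.evenOdd (0 : QuadraticForm ℝ (Fin m → ℝ)) (1 + 0)) ?_ ?_ ?_ x hx
    · intro r
      rw [CliffordAlgebra.contractLeft_algebraMap]
      exact Submodule.zero_mem _
    · intro x y _ _ hx hy
      rw [map_add]
      exact Submodule.add_mem _ hx hy
    · exact fun v w x hx ih => step 0 v w x hx ih
  · refine CliffordAlgebra.odd_induction _ (P := fun x _ => CliffordAlgebra.contractLeft d x ∈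
      CliffordAlgebra.evenOdd (0 : QuadraticForm ℝ (Fin m → ℝ)) (1 + 1)) ?_ ?_ ?_ x hx
    · intro v
      rw [CliffordAlgebra.contractLeft_ι]
      exact SetLike.algebraMap_mem_graded
        (CliffordAlgebra.evenOdd (0 : QuadraticForm ℝ (Fin m → ℝ))) _
    · intro x y _ _ hx hy
      rw [map_add]
      exact Submodule.add_mem _ hx hy
    · exact fun v w x hx ih => step 1 v w x hx ih

/-- The partial derivative `∂/∂θ^i` of the Grassmann algebra. -/
noncomputable def grassmannPartial (i : Fin m) : Grassmann m →ₗ[ℝ] Grassmann m :=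
  CliffordAlgebra.contractLeft (Q := (0 : QuadraticForm ℝ (Fin m → ℝ))) (LinearMap.proj i)

theorem grassmannPartial_one (i : Fin m) : grassmannPartial i 1 = 0 :=
  CliffordAlgebra.contractLeft_one _ _

theorem grassmannPartial_ι (i : Fin m) (v : Fin m → ℝ) :
    grassmannPartial i (ExteriorAlgebra.ι ℝ v) = algebraMap ℝ _ (v i) :=
  CliffordAlgebra.contractLeft_ι _ _ _

theorem grassmannPartial_comm (i j : Fin m) (x : Grassmann m) :
    grassmannPartial i (grassmannPartial j x) =
      (-1 : ℝ) • grassmannPartial j (grassmannPartial i x) := by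
  rw [neg_smul, one_smul]
  exact CliffordAlgebra.contractLeft_comm _ _ _

theorem grassmannPartial_mul (i : Fin m) {q : ZMod 2} {x : Grassmann m}
    (hx : x ∈ grassmannParity m q) (y : Grassmann m) :
    grassmannPartial i (x * y) =
      grassmannPartial i x * y + sgn q • (x * grassmannPartial i y) :=
  contract_mul _ hx y

theorem tmul_mem_modelParity (f : smoothFun W) {q : ZMod 2} {w : Grassmann m}
    (hw : w ∈ grassmannParity m q) : f ⊗ₜ[ℝ] w ∈ modelParity m W q :=
  Submodule.tmul_mem_baseChange_of_mem f hw

theorem modelParity_induction {q : ZMod 2} {P : ModelAlg m W → Prop}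
    (h0 : P 0) (hadd : ∀ a b, P a → P b → P (a + b))
    (htmul : ∀ (f : smoothFun W) (w : Grassmann m), w ∈ grassmannParity m q → P (f ⊗ₜ[ℝ] w))
    {z : ModelAlg m W} (hz : z ∈ modelParity m W q) : P z := by
  obtain ⟨y, rfl⟩ := hz
  induction y using TensorProduct.induction_on with
  | zero => rw [map_zero]; exact h0
  | tmul f w => exact htmul f w.1 w.2
  | add a b ha hb => rw [map_add]; exact hadd _ _ ha hb

theorem modelPartial_inl_tmul (μ : Fin n) (f : smoothFun W) (w : Grassmann m) :
    modelPartial W (Sum.inl μ) (f ⊗ₜ[ℝ] w) = smoothPartial W μ f ⊗ₜ[ℝ] w := rfl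

theorem modelPartial_inr_tmul (i : Fin m) (f : smoothFun W) (w : Grassmann m) :
    modelPartial W (Sum.inr i) (f ⊗ₜ[ℝ] w) =
      f ⊗ₜ[ℝ] grassmannPartial i w := rfl

theorem isSuperDer_modelPartial (a : Fin n ⊕ Fin m) :
    IsSuperDer (R := ModelAlg m W) (modelParity m W) (idxParity a) (modelPartial W a) where
  map_parity q z hz := by
    refine modelParity_induction (P := fun z => modelPartial W a z ∈ modelParity m W _) ?_ ?_ ?_ hz
    · rw [map_zero]; exact Submodule.zero_mem _
    · intro a b ha hb; rw [map_add]; exact Submodule.add_mem _ ha hb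
    · intro f w hw
      cases a with
      | inl μ =>
        rw [modelPartial_inl_tmul]
        exact tmul_mem_modelParity _ (by simpa [idxParity] using hw)
      | inr i =>
        rw [modelPartial_inr_tmul]
        exact tmul_mem_modelParity _ (contract_mem _ q hw)
  leibniz q z z' hz := by
    refine modelParity_induction (P := fun z => modelPartial W a (z * z') =
      modelPartial W a z * z' + sgn (idxParity a * q) • (z * modelPartial W a z')) ?_ ?_ ?_ hz
    · simp
    · intro x y hx hy
      simp only [add_mul, map_add, hx, hy, smul_add]
      abel
    · intro f w hw
      induction z' using TensorProduct.induction_on with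
      | zero => simp
      | add x y hx hy =>
        simp only [mul_add, map_add, hx, hy, smul_add]
        abel
      | tmul g η =>
        cases a with
        | inl μ =>
          rw [Algebra.TensorProduct.tmul_mul_tmul]
          simp only [modelPartial_inl_tmul, Algebra.TensorProduct.tmul_mul_tmul, idxParity,
            zero_mul, sgn_zero, one_smul, smoothPartial_mul, TensorProduct.add_tmul]
        | inr i =>
          rw [Algebra.TensorProduct.tmul_mul_tmul]
          simp only [modelPartial_inr_tmul, Algebra.TensorProduct.tmul_mul_tmul, idxParity,
            one_mul, grassmannPartial_mul i hw, TensorProduct.tmul_add, TensorProduct.tmul_smul]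

theorem modelCoord_mem (a : Fin n ⊕ Fin m) : modelCoord W a ∈ modelParity m W (idxParity a) := by
  cases a with
  | inl μ => exact tmul_mem_modelParity _ (SetLike.one_mem_graded _)
  | inr i => exact tmul_mem_modelParity _ (CliffordAlgebra.ι_mem_evenOdd_one _ _)

theorem modelPartial_coord (a b : Fin n ⊕ Fin m) :
    modelPartial W a (modelCoord W b) = if a = b then 1 else 0 := by
  rcases a with μ | i <;> rcases b with ν | j
  · simp only [modelCoord, modelPartial_inl_tmul, smoothPartial_coord, Sum.inl.injEq]
    split_ifs
    · rfl
    · exact TensorProduct.zero_tmul _ _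
  · have : smoothPartial W μ (1 : smoothFun W) = 0 := by
      have := smoothPartial_mul μ (1 : smoothFun W) 1
      rwa [mul_one, mul_one, one_mul, left_eq_add] at this
    rw [if_neg Sum.inl_ne_inr, modelCoord, modelPartial_inl_tmul, this, TensorProduct.zero_tmul]
  · rw [if_neg Sum.inr_ne_inl, modelCoord, modelPartial_inr_tmul, grassmannPartial_one,
      TensorProduct.tmul_zero]
  · rw [modelCoord, modelPartial_inr_tmul, grassmannPartial_ι]
    by_cases h : i = j
    · subst h
      rw [if_pos rfl, Pi.single_eq_same, map_one]
      rfl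
    · rw [if_neg (fun e => h (Sum.inr.inj e)), Pi.single_eq_of_ne h, map_zero,
        TensorProduct.tmul_zero]

theorem modelPartial_comm (a b : Fin n ⊕ Fin m) (z : ModelAlg m W) :
    modelPartial W a (modelPartial W b z) =
      sgn (idxParity a * idxParity b) • modelPartial W b (modelPartial W a z) := by
  induction z using TensorProduct.induction_on with
  | zero => simp
  | add x y hx hy => simp only [map_add, hx, hy, smul_add]
  | tmul f w =>
    rcases a with μ | i <;> rcases b with ν | j
    · simp only [modelPartial_inl_tmul, idxParity, zero_mul, sgn_zero, one_smul,
        smoothPartial_comm μ ν]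
    · simp only [modelPartial_inl_tmul, modelPartial_inr_tmul, idxParity, zero_mul, sgn_zero,
        one_smul]
    · simp only [modelPartial_inl_tmul, modelPartial_inr_tmul, idxParity, mul_zero, sgn_zero,
        one_smul]
    · simp only [modelPartial_inr_tmul, idxParity, mul_one, sgn_one]
      rw [grassmannPartial_comm, TensorProduct.tmul_smul]

theorem superCoords_model :
    SuperCoords (modelParity m W) idxParity (modelCoord (n := n) (m := m) W) (modelPartial W) where
  mem := modelCoord_mem
  der := isSuperDer_modelPartial
  map_coord := modelPartial_coord
  comm := modelPartial_comm

theorem modelRes_tmul {W' : Opens (Rn n)} (h : W' ≤ W) (f : smoothFun W) (w : Grassmann m) :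
    modelRes m h (f ⊗ₜ[ℝ] w) = smoothRes h f ⊗ₜ[ℝ] w := rfl

theorem modelPartial_res {W' : Opens (Rn n)} (h : W' ≤ W) (a : Fin n ⊕ Fin m) (z : ModelAlg m W) :
    modelPartial W' a (modelRes m h z) = modelRes m h (modelPartial W a z) := by
  induction z using TensorProduct.induction_on with
  | zero => simp
  | add x y hx hy => simp only [map_add, hx, hy]
  | tmul f w =>
    cases a with
    | inl μ => simp only [modelRes_tmul, modelPartial_inl_tmul, smoothPartial_res]
    | inr i => simp only [modelRes_tmul, modelPartial_inr_tmul]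

theorem modelRes_coord {W' : Opens (Rn n)} (h : W' ≤ W) (a : Fin n ⊕ Fin m) :
    modelRes m h (modelCoord W a) = modelCoord W' a := by
  cases a with
  | inl μ => rfl
  | inr i =>
    simp only [modelCoord, modelRes_tmul, map_one]

end Model

/-! ### Hadamard's lemma -/

section Hadamard

/-- Differentiation under the integral sign, iterated. `V` is quantified inside the induction
because the derivative takes values in `H →L[ℝ] V`, and shares the universe of `H` so that this
space is again admissible. -/
theorem contDiff_intervalIntegral {H : Type u} [NormedAddCommGroup H] [NormedSpace ℝ H]
    [ProperSpace H] (k : ℕ) : ∀ {V : Type u} [NormedAddCommGroup V] [NormedSpace ℝ V]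
    [CompleteSpace V] {Φ : H × ℝ → V}, ContDiff ℝ ∞ Φ →
      ContDiff ℝ k fun x => ∫ t in (0 : ℝ)..1, Φ (x, t) := by
  induction k with
  | zero =>
    intro V _ _ _ Φ hΦ
    exact contDiff_zero.2 (intervalIntegral.continuous_parametric_intervalIntegral_of_continuous'
      (f := fun x t => Φ (x, t)) hΦ.continuous 0 1)
  | succ k ih =>
    intro V _ _ _ Φ hΦ
    have hΦ' : ContDiff ℝ ∞ fun z => (fderiv ℝ Φ z).comp (ContinuousLinearMap.inl ℝ H ℝ) :=
      (hΦ.fderiv_right (m := ∞) (by simp)).clm_comp contDiff_const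
    have hder : ∀ x, HasFDerivAt (fun x => ∫ t in (0 : ℝ)..1, Φ (x, t))
        (∫ t in (0 : ℝ)..1, (fderiv ℝ Φ (x, t)).comp (ContinuousLinearMap.inl ℝ H ℝ)) x := by
      intro x
      -- The dominating constant comes from compactness of a closed ball times `[0, 1]`.
      obtain ⟨C, hC⟩ := ((isCompact_closedBall x 1).prod
        (isCompact_Icc (a := (0 : ℝ)) (b := 1))).exists_bound_of_continuousOn
        hΦ'.continuous.continuousOn
      have hc : ∀ y : H, Continuous fun t : ℝ => Φ (y, t) := fun y =>
        hΦ.continuous.comp (by fun_prop)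
      refine intervalIntegral.hasFDerivAt_integral_of_dominated_of_fderiv_le
        (𝕜 := ℝ) (μ := MeasureTheory.volume) (F := fun x t => Φ (x, t))
        (F' := fun x t => (fderiv ℝ Φ (x, t)).comp (ContinuousLinearMap.inl ℝ H ℝ))
        (a := 0) (b := 1) (bound := fun _ => C)
        (Metric.closedBall_mem_nhds x one_pos)
        (Filter.Eventually.of_forall fun y => (hc y).aestronglyMeasurable)
        ((hc x).intervalIntegrable _ _) ?_ ?_ intervalIntegrable_const ?_
      · exact (hΦ'.continuous.comp
          (by fun_prop : Continuous fun t : ℝ => (x, t))).aestronglyMeasurable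
      · refine Filter.Eventually.of_forall fun t ht y hy => hC (y, t) ⟨hy, ?_⟩
        rw [Set.uIoc_of_le zero_le_one] at ht
        exact ⟨ht.1.le, ht.2⟩
      · refine Filter.Eventually.of_forall fun t _ y _ => ?_
        have h1 : HasFDerivAt Φ (fderiv ℝ Φ (y, t)) (y, t) :=
          (hΦ.differentiable (by simp) _).hasFDerivAt
        exact h1.comp y (hasFDerivAt_prodMk_left y t)
    have hfd : fderiv ℝ (fun x => ∫ t in (0 : ℝ)..1, Φ (x, t)) =
        fun x => ∫ t in (0 : ℝ)..1, (fderiv ℝ Φ (x, t)).comp (ContinuousLinearMap.inl ℝ H ℝ) :=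
      funext fun x => (hder x).fderiv
    push_cast
    rw [contDiff_succ_iff_fderiv]
    refine ⟨fun x => (hder x).differentiableAt, by simp, ?_⟩
    rw [hfd]
    exact ih hΦ'

/-- Hadamard's lemma. -/
theorem exists_hadamard {n : ℕ} {F : Rn n → ℝ} (hF : ContDiff ℝ ∞ F) (p : Rn n) :
    ∃ g : Fin n → Rn n → ℝ, (∀ μ, ContDiff ℝ ∞ (g μ)) ∧
      ∀ x, F x = F p + ∑ μ, (x μ - p μ) * g μ x := by
  have hF' : ContDiff ℝ ∞ (fderiv ℝ F) := hF.fderiv_right (by simp)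
  have hline : ContDiff ℝ ∞ fun z : Rn n × ℝ => p + z.2 • (z.1 - p) := by fun_prop
  -- The coefficients are averages of `∂_μ F` over the segment from `p` to `x`; the fundamental
  -- theorem of calculus along it gives the identity.
  refine ⟨fun μ x => ∫ t in (0 : ℝ)..1,
    fderiv ℝ F (p + t • (x - p)) (EuclideanSpace.single μ (1 : ℝ)), fun μ => ?_, fun x => ?_⟩
  · refine contDiff_infty.2 fun k => contDiff_intervalIntegral k
      (Φ := fun z => fderiv ℝ F (p + z.2 • (z.1 - p)) (EuclideanSpace.single μ (1 : ℝ))) ?_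
    exact (hF'.comp hline).clm_apply contDiff_const
  · have hc : Continuous fun t : ℝ => fderiv ℝ F (p + t • (x - p)) :=
      hF'.continuous.comp (by fun_prop)
    have hder : ∀ t : ℝ, HasDerivAt (fun t : ℝ => F (p + t • (x - p)))
        (fderiv ℝ F (p + t • (x - p)) (x - p)) t := by
      intro t
      have h1 : HasDerivAt (fun t : ℝ => p + t • (x - p)) (x - p) t := by
        simpa using ((hasDerivAt_id t).smul_const (x - p)).const_add p
      exact ((hF.differentiable (by simp) _).hasFDerivAt).comp_hasDerivAt t h1
    have hint := intervalIntegral.integral_eq_sub_of_hasDerivAt (a := 0) (b := 1)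
      (fun t _ => hder t) ((hc.clm_apply continuous_const).intervalIntegrable _ _)
    simp only [one_smul, add_sub_cancel, zero_smul, add_zero] at hint
    have hdec : x - p = ∑ μ, (x μ - p μ) • EuclideanSpace.single μ (1 : ℝ) := by
      ext ν
      simp [Pi.single_apply]
    have h2 : ∀ t : ℝ, fderiv ℝ F (p + t • (x - p)) (x - p) = ∑ μ, (x μ - p μ) *
        fderiv ℝ F (p + t • (x - p)) (EuclideanSpace.single μ (1 : ℝ)) := by
      intro t
      conv_lhs => rw [hdec]
      rw [map_sum]
      simp only [map_smul, smul_eq_mul]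
      rw [← hdec]
    simp only [h2] at hint
    rw [intervalIntegral.integral_finsetSum] at hint
    · simp only [intervalIntegral.integral_const_mul] at hint
      rw [hint]; ring
    · intro μ _
      exact (continuous_const.mul (hc.clm_apply continuous_const)).intervalIntegrable _ _

/-- A smooth function on `W` agrees near a given point with a smooth function on `ℝⁿ`. -/
theorem exists_global_smooth {n : ℕ} {W : Opens (Rn n)} (f : smoothFun W) (p : W) :
    ∃ (F : Rn n → ℝ) (B : Opens (Rn n)), ContDiff ℝ ∞ F ∧ p.1 ∈ B ∧
      ∀ x : W, x.1 ∈ B → F x = f.1 x := by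
  obtain ⟨r, hr, hrW⟩ := Metric.nhds_basis_closedBall.mem_iff.1 (W.isOpen.mem_nhds p.2)
  let φ : ContDiffBump p.1 := ⟨r / 2, r, by positivity, by linarith⟩
  refine ⟨fun x => φ x * extendFun f x, ⟨Metric.ball p.1 (r / 2), Metric.isOpen_ball⟩, ?_,
    Metric.mem_ball_self (by positivity), fun x hx => ?_⟩
  · refine contDiff_iff_contDiffAt.2 fun x => ?_
    by_cases hx : x ∈ tsupport φ
    · rw [φ.tsupport_eq] at hx
      exact φ.contDiff.contDiffAt.mul (contDiffAt_extendFun f ⟨x, hrW hx⟩)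
    · refine (contDiffAt_const (c := (0 : ℝ))).congr_of_eventuallyEq ?_
      filter_upwards [notMem_tsupport_iff_eventuallyEq.1 hx] with y hy
      rw [hy, Pi.zero_apply, zero_mul]
  · change φ x.1 * extendFun f x = f.1 x
    rw [φ.one_of_mem_closedBall (Metric.ball_subset_closedBall hx), one_mul, extendFun_apply]

end Hadamard

/-! ### Superderivations of the model -/

theorem IsSuperDer.map_sub_smul_one_mul {R : Type*} [Ring R] [Algebra ℝ R]
    {gr : ZMod 2 → Submodule ℝ R} {p : ZMod 2} {D : R →ₗ[ℝ] R} (hD : IsSuperDer gr p D)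
    (h : IsSuperCommAlgebra gr) {x : R} (hx : x ∈ gr 0) (h0 : D x = 0) (r : ℝ) (g : R) :
    D ((x - r • 1) * g) = (x - r • 1) * D g := by
  rw [hD.leibniz_even _ (Submodule.sub_mem _ hx (Submodule.smul_mem _ _ h.one_mem)), map_sub,
    map_smul, h0, hD.map_one h, smul_zero, sub_zero, zero_mul, zero_add]

section Eval

variable {n m : ℕ} {W : Opens (Rn n)}

/-- Evaluation of smooth functions at a point. -/
noncomputable def evalSmooth (p : W) : smoothFun W →ₐ[ℝ] ℝ :=
  (Pi.evalAlgHom ℝ (fun _ : W => ℝ) p).comp (smoothFun W).val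

/-- Evaluation of the coefficients of a superfunction at a point. -/
noncomputable def evalModel (p : W) : ModelAlg m W →ₐ[ℝ] Grassmann m :=
  (Algebra.TensorProduct.lid ℝ (Grassmann m)).toAlgHom.comp
    (Algebra.TensorProduct.map (evalSmooth p) (AlgHom.id ℝ (Grassmann m)))

theorem evalModel_tmul (p : W) (f : smoothFun W) (w : Grassmann m) :
    evalModel p (f ⊗ₜ[ℝ] w) = f.1 p • w := by
  simp only [evalModel, AlgHom.comp_apply, Algebra.TensorProduct.map_tmul]
  exact TensorProduct.lid_tmul _ _

theorem evalModel_res {W' : Opens (Rn n)} (h : W' ≤ W) (p : W') (z : ModelAlg m W) :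
    evalModel p (modelRes m h z) = evalModel ⟨p.1, h p.2⟩ z := by
  induction z using TensorProduct.induction_on with
  | zero => simp only [map_zero]
  | add x y hx hy => simp only [map_add, hx, hy]
  | tmul f w =>
    rw [modelRes_tmul, evalModel_tmul, evalModel_tmul]
    rfl

/-- In a basis of the Grassmann algebra the coefficients are functions on `W`, and vanishing at
every point kills each of them. -/
theorem eq_zero_of_evalModel {z : ModelAlg m W} (h : ∀ p : W, evalModel p z = 0) : z = 0 := by
  let C := Module.Basis.ofVectorSpace ℝ (Grassmann m)
  obtain ⟨b, rfl⟩ := TensorProduct.eq_repr_basis_right C z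
  have hb : b = 0 := by
    ext i p
    have hp := h p
    rw [Finsupp.sum, map_sum] at hp
    simp only [evalModel_tmul] at hp
    by_cases hi : i ∈ b.support
    · exact linearIndependent_iff'.1 C.linearIndependent b.support (fun i => (b i).1 p) hp i hi
    · rw [Finsupp.notMem_support_iff.1 hi]
      rfl
  rw [hb, Finsupp.sum_zero_index]

/-- The restriction to `W` of a smooth function on `ℝⁿ`. -/
noncomputable def restrictSmooth (W : Opens (Rn n)) {F : Rn n → ℝ} (hF : ContDiff ℝ ∞ F) :
    smoothFun W :=
  ⟨fun x => F x, mem_smoothFun_of_contDiffOn hF.contDiffOn⟩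

theorem map_one_tmul_eq_zero {p : ZMod 2} {D : ModelAlg m W →ₗ[ℝ] ModelAlg m W}
    (h : IsSuperCommAlgebra (R := ModelAlg m W) (modelParity m W))
    (hD : IsSuperDer (R := ModelAlg m W) (modelParity m W) p D)
    (h0 : ∀ i, D (modelCoord W (Sum.inr i)) = 0) (w : Grassmann m) : D (1 ⊗ₜ[ℝ] w) = 0 := by
  have hι : ∀ v : Fin m → ℝ, D (1 ⊗ₜ[ℝ] ExteriorAlgebra.ι ℝ v) = 0 := by
    intro v
    have hv : v = ∑ i, v i • Pi.single i (1 : ℝ) := by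
      ext j
      simp [Pi.single_apply]
    rw [hv, map_sum, TensorProduct.tmul_sum, map_sum]
    refine Finset.sum_eq_zero fun i _ => ?_
    rw [map_smul, TensorProduct.tmul_smul, map_smul]
    refine (congrArg _ (h0 i)).trans (smul_zero _)
  have h1 : D 1 = 0 := hD.map_one h
  refine CliffordAlgebra.left_induction (0 : QuadraticForm ℝ (Fin m → ℝ))
    (P := fun w : Grassmann m => D (1 ⊗ₜ[ℝ] w) = 0) ?_ ?_ ?_ w
  · intro r
    have : (1 : smoothFun W) ⊗ₜ[ℝ] (algebraMap ℝ (Grassmann m) r) = r • (1 : ModelAlg m W) := by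
      rw [Algebra.algebraMap_eq_smul_one, TensorProduct.tmul_smul]
      rfl
    exact (congrArg D this).trans (by rw [map_smul, h1, smul_zero])
  · intro x y hx hy
    have : (1 : smoothFun W) ⊗ₜ[ℝ] ((x + y : Grassmann m)) = 1 ⊗ₜ x + 1 ⊗ₜ y :=
      TensorProduct.tmul_add _ _ _
    exact (congrArg D this).trans (by rw [map_add, hx, hy, add_zero])
  · intro x v hx
    have e : (1 : smoothFun W) ⊗ₜ[ℝ] (ExteriorAlgebra.ι ℝ v * x : Grassmann m) =
        ((1 : smoothFun W) ⊗ₜ[ℝ] ExteriorAlgebra.ι ℝ v) * (1 ⊗ₜ[ℝ] x) := by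
      rw [Algebra.TensorProduct.tmul_mul_tmul, one_mul]
    refine (congrArg D e).trans ?_
    rw [hD.leibniz 1 _ _ (tmul_mem_modelParity _ (CliffordAlgebra.ι_mem_evenOdd_one _ v)), hι, hx,
      zero_mul, mul_zero, smul_zero, add_zero]

theorem tmul_one_mem (f : smoothFun W) : f ⊗ₜ[ℝ] (1 : Grassmann m) ∈ modelParity m W 0 :=
  tmul_mem_modelParity _
    (SetLike.one_mem_graded (CliffordAlgebra.evenOdd (0 : QuadraticForm ℝ (Fin m → ℝ))))

/-- By Hadamard, `F - F(x)` is a combination of the `x^μ - x^μ(x)`. As `D` kills these factors, `D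
F` is a combination of them too and vanishes at `x`. -/
theorem evalModel_map_restrictSmooth {p : ZMod 2} {D : ModelAlg m W →ₗ[ℝ] ModelAlg m W}
    (h : IsSuperCommAlgebra (R := ModelAlg m W) (modelParity m W))
    (hD : IsSuperDer (R := ModelAlg m W) (modelParity m W) p D)
    (h0 : ∀ μ, D (modelCoord W (Sum.inl μ)) = 0) {F : Rn n → ℝ} (hF : ContDiff ℝ ∞ F) (x : W) :
    evalModel x (D (restrictSmooth W hF ⊗ₜ[ℝ] 1)) = 0 := by
  obtain ⟨g, hg, hFg⟩ := exists_hadamard hF x.1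
  have h1 : D 1 = 0 := hD.map_one h
  have e : restrictSmooth W hF ⊗ₜ[ℝ] (1 : Grassmann m) = F x • (1 : ModelAlg m W) +
      ∑ μ, (modelCoord W (Sum.inl μ) - (x.1 μ) • 1) * (restrictSmooth W (hg μ) ⊗ₜ[ℝ] 1) := by
    have e1 : restrictSmooth W hF = F x • 1 +
        ∑ μ, (smoothCoord W μ - (x.1 μ) • 1) * restrictSmooth W (hg μ) := by
      ext y
      refine (hFg y).trans ?_
      rw [← Subalgebra.coe_val, map_add, map_sum]
      simp only [map_mul, map_sub, map_smul, map_one]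
      simp [smoothCoord, restrictSmooth]
    rw [e1, TensorProduct.add_tmul, TensorProduct.sum_tmul]
    congr 1
    refine Finset.sum_congr rfl fun μ _ => ?_
    rw [modelCoord, Algebra.TensorProduct.one_def, TensorProduct.smul_tmul',
      ← TensorProduct.sub_tmul, Algebra.TensorProduct.tmul_mul_tmul, one_mul]
  rw [e, map_add, map_smul, h1, smul_zero, zero_add, map_sum, map_sum]
  refine Finset.sum_eq_zero fun μ _ => ?_
  rw [hD.map_sub_smul_one_mul h (modelCoord_mem (Sum.inl μ)) (h0 μ), map_mul]
  have : evalModel x (modelCoord W (Sum.inl μ) - (x.1 μ) • (1 : ModelAlg m W)) = 0 := by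
    rw [modelCoord, Algebra.TensorProduct.one_def, TensorProduct.smul_tmul',
      ← TensorProduct.sub_tmul, evalModel_tmul]
    have : (smoothCoord W μ - (x.1 μ) • 1).1 x = 0 := by
      simp [smoothCoord]
    rw [this, zero_smul]
  rw [this, zero_mul]

end Eval

/-! ### Transport along isomorphisms -/

section Transport

variable {R S : Type*} [Ring R] [Algebra ℝ R] [Ring S] [Algebra ℝ S]
  {gr : ZMod 2 → Submodule ℝ R} {gr' : ZMod 2 → Submodule ℝ S} (φ : R ≃ₐ[ℝ] S)

/-- The linear endomorphism `φ ∘ D ∘ φ⁻¹`. -/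
def conjLinear (D : R →ₗ[ℝ] R) : S →ₗ[ℝ] S :=
  φ.toLinearMap ∘ₗ D ∘ₗ φ.symm.toLinearMap

theorem conjLinear_apply (D : R →ₗ[ℝ] R) (f : R) : conjLinear φ D (φ f) = φ (D f) := by
  simp [conjLinear]

theorem IsSuperCommAlgebra.transport (h : IsSuperCommAlgebra gr)
    (hφ : ∀ p f, f ∈ gr p ↔ φ f ∈ gr' p) : IsSuperCommAlgebra gr' where
  graded :=
    { one_mem := by
        rw [← map_one φ, ← hφ]
        exact h.one_mem
      mul_mem := fun {p q a b} ha hb => by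
        obtain ⟨a, rfl⟩ := φ.surjective a
        obtain ⟨b, rfl⟩ := φ.surjective b
        rw [← map_mul, ← hφ]
        exact h.mul_mem ((hφ _ _).2 ha) ((hφ _ _).2 hb) }
  isCompl := by
    refine ⟨Submodule.disjoint_def.2 fun a h0 h1 => ?_,
      Submodule.codisjoint_iff_exists_add_eq.2 fun a => ?_⟩
    · obtain ⟨a, rfl⟩ := φ.surjective a
      rw [h.eq_zero_of_mem ((hφ 0 a).2 h0) ((hφ 1 a).2 h1), map_zero]
    · obtain ⟨a, rfl⟩ := φ.surjective a
      obtain ⟨x, hx, y, hy, rfl⟩ := h.exists_add a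
      exact ⟨φ x, φ y, (hφ _ _).1 hx, (hφ _ _).1 hy, (map_add φ x y).symm⟩
  super_comm p q a b ha hb := by
    obtain ⟨a, rfl⟩ := φ.surjective a
    obtain ⟨b, rfl⟩ := φ.surjective b
    rw [← map_mul, h.super_comm p q a b ((hφ _ _).2 ha) ((hφ _ _).2 hb), map_smul, map_mul]

theorem IsSuperDer.transport {p : ZMod 2} {D : R →ₗ[ℝ] R} (hD : IsSuperDer gr p D)
    (hφ : ∀ p f, f ∈ gr p ↔ φ f ∈ gr' p) : IsSuperDer gr' p (conjLinear φ D) where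
  map_parity q a ha := by
    obtain ⟨a, rfl⟩ := φ.surjective a
    rw [conjLinear_apply, ← hφ]
    exact hD.map_parity q a ((hφ _ _).2 ha)
  leibniz q a b ha := by
    obtain ⟨a, rfl⟩ := φ.surjective a
    obtain ⟨b, rfl⟩ := φ.surjective b
    rw [← map_mul, conjLinear_apply, hD.leibniz q a b ((hφ _ _).2 ha), conjLinear_apply,
      conjLinear_apply, map_add, map_mul, map_smul, map_mul]

theorem SuperCoords.transport {ι : Type*} [DecidableEq ι] {par : ι → ZMod 2} {x : ι → R}
    {D : ι → R →ₗ[ℝ] R} (c : SuperCoords gr par x D) (hφ : ∀ p f, f ∈ gr p ↔ φ f ∈ gr' p) :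
    SuperCoords gr' par (fun a => φ (x a)) (fun a => conjLinear φ (D a)) where
  mem a := (hφ _ _).1 (c.mem a)
  der a := (c.der a).transport φ hφ
  map_coord a b := by
    rw [conjLinear_apply, c.map_coord]
    split_ifs
    · exact map_one φ
    · exact map_zero φ
  comm a b f := by
    obtain ⟨f, rfl⟩ := φ.surjective f
    simp only [conjLinear_apply, c.comm a b f, map_smul]

end Transport

/-! ### Coordinates of charts -/

namespace Chart

variable {M : SuperSpace.{u}} {n m : ℕ} (c : Chart M n m) {W W' : Opens M.space}

theorem iso_partialD (hW : W ≤ c.dom) (a : Fin n ⊕ Fin m) (f : M.O W) :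
    c.iso W hW (c.partialD hW a f) = modelPartial (imageOpens c.e W) a (c.iso W hW f) :=
  (c.iso W hW).apply_symm_apply _

theorem iso_coord (hW : W ≤ c.dom) (a : Fin n ⊕ Fin m) :
    c.iso W hW (c.coord hW a) = modelCoord (imageOpens c.e W) a :=
  (c.iso W hW).apply_symm_apply _

theorem superCoords (hW : W ≤ c.dom) :
    SuperCoords (M.parity W) idxParity (c.coord hW) (c.partialD hW) :=
  (superCoords_model (m := m) (W := imageOpens c.e W)).transport (c.iso W hW).symm fun p f => by
    rw [c.iso_parity W hW, AlgEquiv.apply_symm_apply]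

theorem res_coord (h : W' ≤ W) (hW : W ≤ c.dom) (a : Fin n ⊕ Fin m) :
    M.res h (c.coord hW a) = c.coord (h.trans hW) a := by
  apply (c.iso W' (h.trans hW)).injective
  rw [iso_coord, c.iso_res W' W h hW, iso_coord, modelRes_coord]

theorem res_partialD (h : W' ≤ W) (hW : W ≤ c.dom) (a : Fin n ⊕ Fin m) (f : M.O W) :
    c.partialD (h.trans hW) a (M.res h f) = M.res h (c.partialD hW a f) := by
  apply (c.iso W' (h.trans hW)).injective
  rw [iso_partialD, c.iso_res W' W h hW, c.iso_res W' W h hW, iso_partialD, modelPartial_res]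

/-- Supercommutativity of the model is inherited from the structure sheaf through the chart. -/
theorem isSuper_model (hW : W ≤ c.dom) : IsSuperCommAlgebra (R := ModelAlg m (imageOpens c.e W))
    (modelParity m (imageOpens c.e W)) :=
  (M.isSuper W).transport (c.iso W hW) (c.iso_parity W hW)

end Chart

/-- A superderivation of parity `p` of the structure sheaf over the open set `W`. -/
structure LocalSuperDer (M : SuperSpace.{u}) (W : Opens M.space) (p : ZMod 2) where
  toFun : ∀ U : Opens M.space, U ≤ W → (M.O U →ₗ[ℝ] M.O U)
  map_res : ∀ {U V : Opens M.space} (h : U ≤ V) (hV : V ≤ W) (f : M.O V),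
    toFun U (h.trans hV) (M.res h f) = M.res h (toFun V hV f)
  der : ∀ U hU, IsSuperDer (M.parity U) p (toFun U hU)

/-! ### Superderivations are determined by their values on coordinates -/

namespace LocalSuperDer

variable {M : SuperSpace.{u}} {n m : ℕ} (c : Chart M n m) {W : Opens M.space} {p : ZMod 2}

/-- The coordinate expression of a superderivation on the model. -/
noncomputable def toModel (X : LocalSuperDer M W p) (hW : W ≤ c.dom) (U : Opens M.space)
    (hU : U ≤ W) : ModelAlg m (imageOpens c.e U) →ₗ[ℝ] ModelAlg m (imageOpens c.e U) :=
  conjLinear (S := ModelAlg m (imageOpens c.e U)) (c.iso U (hU.trans hW)) (X.toFun U hU)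

theorem toModel_apply (X : LocalSuperDer M W p) (hW : W ≤ c.dom) (U : Opens M.space)
    (hU : U ≤ W) (f : M.O U) : X.toModel c hW U hU (c.iso U (hU.trans hW) f) =
      c.iso U (hU.trans hW) (X.toFun U hU f) :=
  conjLinear_apply (S := ModelAlg m (imageOpens c.e U)) _ _ _

theorem isSuperDer_toModel (X : LocalSuperDer M W p) (hW : W ≤ c.dom) (U : Opens M.space)
    (hU : U ≤ W) : IsSuperDer (R := ModelAlg m (imageOpens c.e U))
      (modelParity m (imageOpens c.e U)) p (X.toModel c hW U hU) :=
  (X.der U hU).transport (S := ModelAlg m (imageOpens c.e U)) (c.iso U (hU.trans hW))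
    (c.iso_parity U (hU.trans hW))

theorem toModel_res (X : LocalSuperDer M W p) (hW : W ≤ c.dom) {U V : Opens M.space}
    (h : U ≤ V) (hV : V ≤ W) (z : ModelAlg m (imageOpens c.e V)) :
    X.toModel c hW U (h.trans hV) (modelRes m (imageOpens_mono c.e h) z) =
      modelRes m (imageOpens_mono c.e h) (X.toModel c hW V hV z) := by
  obtain ⟨f, rfl⟩ := (c.iso V (hV.trans hW)).surjective z
  rw [toModel_apply, ← c.iso_res U V h (hV.trans hW), toModel_apply, X.map_res h hV,
    c.iso_res U V h (hV.trans hW)]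

theorem eq_zero (X : LocalSuperDer M W p) (hW : W ≤ c.dom)
    (h0 : ∀ a, X.toFun W le_rfl (c.coord hW a) = 0) (f : M.O W) : X.toFun W le_rfl f = 0 := by
  have h0' : ∀ (U : Opens M.space) (hU : U ≤ W) (a : Fin n ⊕ Fin m),
      X.toModel c hW U hU (modelCoord (imageOpens c.e U) a) = 0 := by
    intro U hU a
    rw [← c.iso_coord (hU.trans hW), toModel_apply, ← c.res_coord hU hW, X.map_res hU le_rfl, h0,
      map_zero, map_zero]
  have hdiff : ∀ g : smoothFun (imageOpens c.e W),
      X.toModel c hW W le_rfl (g ⊗ₜ[ℝ] 1) = 0 := by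
    intro g
    refine eq_zero_of_evalModel fun x => ?_
    obtain ⟨F, B, hF, hxB, hFg⟩ := exists_global_smooth g x
    -- Hadamard's lemma is available for functions on all of `ℝⁿ`, so `W` is shrunk around the point
    -- until `g` is the restriction of such a function. This is where compatibility with
    -- restrictions enters.
    let U : Opens M.space := W ⊓ ⟨c.e.source ∩ c.e ⁻¹' B, c.e.isOpen_inter_preimage B.isOpen⟩
    have hU : U ≤ W := inf_le_left
    have hxU : x.1 ∈ imageOpens c.e U := by
      refine ⟨x.2.1, x.2.2, c.e.map_target x.2.1, ?_⟩
      change c.e (c.e.symm x.1) ∈ B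
      rwa [c.e.right_inv x.2.1]
    have hUB : ∀ y ∈ imageOpens c.e U, y ∈ B := by
      intro y hy
      have : c.e (c.e.symm y) ∈ B := hy.2.2.2
      rwa [c.e.right_inv hy.1] at this
    have hres : modelRes m (imageOpens_mono c.e hU) (g ⊗ₜ[ℝ] 1) =
        restrictSmooth (imageOpens c.e U) hF ⊗ₜ[ℝ] (1 : Grassmann m) := by
      rw [modelRes_tmul]
      congr 1
      ext y
      exact (hFg ⟨y.1, imageOpens_mono c.e hU y.2⟩ (hUB y.1 y.2)).symm
    have key := evalModel_map_restrictSmooth (c.isSuper_model (hU.trans hW))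
      (X.isSuperDer_toModel c hW U hU) (fun μ => h0' U hU (Sum.inl μ)) hF ⟨x.1, hxU⟩
    rw [← hres, X.toModel_res c hW hU le_rfl, evalModel_res] at key
    exact key
  have hall : ∀ z, X.toModel c hW W le_rfl z = 0 := by
    intro z
    induction z using TensorProduct.induction_on with
    | zero => rw [map_zero]
    | add x y hx hy => rw [map_add, hx, hy, add_zero]
    | tmul g w =>
      have e : g ⊗ₜ[ℝ] w = (g ⊗ₜ[ℝ] (1 : Grassmann m)) * ((1 : smoothFun _) ⊗ₜ[ℝ] w) := by
        rw [Algebra.TensorProduct.tmul_mul_tmul, mul_one, one_mul]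
      rw [e, (X.isSuperDer_toModel c hW W le_rfl).leibniz_even _ (tmul_one_mem g), hdiff,
        map_one_tmul_eq_zero (c.isSuper_model hW) (X.isSuperDer_toModel c hW W le_rfl)
          (fun i => h0' W le_rfl (Sum.inr i)), zero_mul, mul_zero, add_zero]
  apply (c.iso W hW).injective
  rw [← X.toModel_apply c hW W le_rfl, hall, map_zero]

/-- A superderivation is determined by its values on the coordinates. -/
theorem expands (X : LocalSuperDer M W p) (hW : W ≤ c.dom) :
    Expands (c.coord hW) (c.partialD hW) (X.toFun W le_rfl) := by
  -- The difference between `X` and its coordinate expression is a superderivation that kills the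
  -- coordinates.
  let Y : LocalSuperDer M W p :=
    { toFun := fun U hU => X.toFun U hU - ∑ a, LinearMap.mulLeft ℝ
        (X.toFun U hU (c.coord (hU.trans hW) a)) ∘ₗ c.partialD (hU.trans hW) a
      map_res := fun {U V} h hV f => by
        simp only [LinearMap.sub_apply, LinearMap.sum_apply, LinearMap.comp_apply,
          LinearMap.mulLeft_apply, map_sub, map_sum, map_mul, X.map_res h hV]
        congr 1
        refine Finset.sum_congr rfl fun a _ => ?_
        rw [c.res_partialD h (hV.trans hW), ← X.map_res h hV, c.res_coord h (hV.trans hW)]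
      der := fun U hU => (X.der U hU).sub (IsSuperDer.sum _ fun a =>
        ((c.superCoords (hU.trans hW)).der a).mulLeft (M.isSuper U)
          ((X.der U hU).map_parity _ _ ((c.superCoords (hU.trans hW)).mem a))
          (by rw [add_assoc, CharTwo.add_self_eq_zero, add_zero])) }
  have hY : ∀ f, Y.toFun W le_rfl f = X.toFun W le_rfl f -
      ∑ a, X.toFun W le_rfl (c.coord hW a) * c.partialD hW a f := by
    intro f
    change (X.toFun W le_rfl - ∑ a, LinearMap.mulLeft ℝ
        (X.toFun W le_rfl (c.coord hW a)) ∘ₗ c.partialD hW a) f = _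
    simp only [LinearMap.sub_apply, LinearMap.sum_apply, LinearMap.comp_apply,
      LinearMap.mulLeft_apply]
  intro f
  have := Y.eq_zero c hW (fun b => by
    rw [hY]
    simp only [(c.superCoords hW).map_coord, mul_ite, mul_one, mul_zero, Finset.sum_ite_eq',
      Finset.mem_univ, if_true, sub_self]) f
  rw [hY, sub_eq_zero] at this
  exact this

end LocalSuperDer

/-! ### The divergence of a vector field -/

/-- The restriction of a vector field to an open set. -/
def HomVectorField.toLocal {n m : ℕ} {M : Supermanifold.{u} n m} {p : ZMod 2}
    (X : HomVectorField M p) (W : Opens M.space) : LocalSuperDer M.toSuperSpace W p where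
  toFun U _ := X.toFun U
  map_res h _ f := X.map_res h f
  der U _ := ⟨X.map_parity U, X.leibniz U⟩

/-- The partial derivatives of a chart as superderivations of the structure sheaf. -/
noncomputable def Chart.partialLocal {n m : ℕ} {M : SuperSpace.{u}} (c : Chart M n m)
    {W : Opens M.space} (hW : W ≤ c.dom) (a : Fin n ⊕ Fin m) :
    LocalSuperDer M W (idxParity a) where
  toFun _ hU := c.partialD (hU.trans hW) a
  map_res h hV f := c.res_partialD h (hV.trans hW) a f
  der _ hU := (c.superCoords (hU.trans hW)).der a

section

variable {n m : ℕ} {M : Supermanifold.{u} n m} {p : ZMod 2}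

theorem HomVectorField.isSuperDer (X : HomVectorField M p) (W : Opens M.space) :
    IsSuperDer (M.parity W) p (X.toFun W) :=
  ⟨X.map_parity W, X.leibniz W⟩

theorem HomVectorField.expands (X : HomVectorField M p) (c : Chart M.toSuperSpace n m)
    {W : Opens M.space} (hW : W ≤ c.dom) :
    Expands (c.coord hW) (c.partialD hW) (X.toFun W) :=
  (X.toLocal W).expands c hW

theorem res_lieCoeff (X : HomVectorField M p) (s : BerezinForm M) (c : Chart M.toSuperSpace n m)
    {W : Opens M.space} (hW : W ≤ c.dom) :
    M.res hW (lieCoeff X s c) = ∑ a, sgn (idxParity a * (p + 1)) •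
      c.partialD hW a (X.toFun W (c.coord hW a) * M.res hW (s.coeff c)) := by
  rw [lieCoeff, map_sum]
  refine Finset.sum_congr rfl fun a _ => ?_
  rw [map_smul, ← c.res_partialD hW le_rfl, map_mul, ← X.map_res, c.res_coord hW le_rfl]

theorem lieCoeff_transform (X : HomVectorField M p) (s : BerezinForm M)
    (c c' : Chart M.toSuperSpace n m) :
    M.res (inf_le_left : c.dom ⊓ c'.dom ≤ c.dom) (lieCoeff X s c) =
      berezinian (c.jacobian c') *
        M.res (inf_le_right : c.dom ⊓ c'.dom ≤ c'.dom) (lieCoeff X s c') := by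
  rw [res_lieCoeff X s c inf_le_left, res_lieCoeff X s c' inf_le_right, s.transform c c']
  exact lie_change (M.isSuper _) (c.superCoords inf_le_left) (c'.superCoords inf_le_right)
    (X.isSuperDer _) (X.expands c inf_le_left) (X.expands c' inf_le_right)
    (fun a => (c.partialLocal inf_le_left a).expands c' inf_le_right)
    (fun a => (c'.partialLocal inf_le_right a).expands c inf_le_left) _

theorem top_le_iSup_dom (M : Supermanifold.{u} n m) :
    ⊤ ≤ ⨆ c : Chart M.toSuperSpace n m, c.dom := fun x _ => by
  obtain ⟨c, hc⟩ := M.locally_model x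
  exact Opens.mem_iSup.2 ⟨c, hc⟩

/-- Functions that agree on all chart domains are equal. -/
theorem Supermanifold.eq_of_res_eq {f g : M.Functions}
    (h : ∀ c : Chart M.toSuperSpace n m,
      M.res (le_top : c.dom ≤ ⊤) f = M.res (le_top : c.dom ≤ ⊤) g) : f = g :=
  M.sheaf.eq_of_locally_eq' (fun c : Chart M.toSuperSpace n m => c.dom) ⊤
    (fun _ => homOfLE le_top) (top_le_iSup_dom M) f g h

/-- Compatible functions on the chart domains glue to a function. -/
theorem Supermanifold.exists_glue (f : ∀ c : Chart M.toSuperSpace n m, M.O c.dom)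
    (h : ∀ c c' : Chart M.toSuperSpace n m,
      M.res (inf_le_left : c.dom ⊓ c'.dom ≤ c.dom) (f c) =
        M.res (inf_le_right : c.dom ⊓ c'.dom ≤ c'.dom) (f c')) :
    ∃ F : M.Functions, ∀ c : Chart M.toSuperSpace n m, M.res (le_top : c.dom ≤ ⊤) F = f c := by
  obtain ⟨F, hF, -⟩ := M.sheaf.existsUnique_gluing' (fun c : Chart M.toSuperSpace n m => c.dom) ⊤
    (fun _ => homOfLE le_top) (top_le_iSup_dom M) f h
  exact ⟨F, hF⟩

/-- The coefficients of `L_X ρ` and of `ρ` change by the same Berezinian, so their quotients agree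
on overlaps and glue. -/
theorem exists_isDivergence (ρ : BerezinVolume M) (X : HomVectorField M p) :
    ∃ f, IsDivergence ρ X f := by
  obtain ⟨F, hF⟩ := Supermanifold.exists_glue
    (fun c => Ring.inverse (ρ.coeff c) * lieCoeff X ρ.toBerezinForm c) fun c c' => by
      have hu := (ρ.isUnit c).map (M.res (inf_le_left : c.dom ⊓ c'.dom ≤ c.dom))
      have hm := M.res_mem_parity (inf_le_right : c.dom ⊓ c'.dom ≤ c'.dom) 0 _ (ρ.even c')
      refine hu.mul_left_cancel ?_
      rw [map_mul, ← mul_assoc, ← map_mul, Ring.mul_inverse_cancel _ (ρ.isUnit c), map_one,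
        one_mul, lieCoeff_transform, ρ.transform c c', mul_assoc, ← map_mul,
        ← mul_assoc (ρ.coeff c'),
        Ring.mul_inverse_cancel _ (ρ.isUnit c'), one_mul]
  refine ⟨F, fun c => ?_⟩
  rw [hF, ← mul_assoc, Ring.mul_inverse_cancel _ (ρ.isUnit c), one_mul]

theorem IsDivergence.unique {ρ : BerezinVolume M} {X : HomVectorField M p} {f g : M.Functions}
    (hf : IsDivergence ρ X f) (hg : IsDivergence ρ X g) : f = g :=
  Supermanifold.eq_of_res_eq fun c => (ρ.isUnit c).mul_left_cancel ((hf c).trans (hg c).symm)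

theorem isDivergence_divergence (ρ : BerezinVolume M) (X : HomVectorField M p) :
    IsDivergence ρ X (divergence ρ X) := by
  have h := exists_isDivergence ρ X
  rw [divergence, dif_pos h]
  exact h.choose_spec

theorem apply_divergence_of_isSymmetry (ρ : BerezinVolume M) {Q : HomVectorField M 1}
    {X : HomVectorField M p} (hX : X.IsSymmetry Q) :
    X.apply (divergence ρ Q) = sgn p • Q.apply (divergence ρ X) := by
  refine Supermanifold.eq_of_res_eq fun c => ?_
  have hXQ : ∀ f, X.toFun c.dom (Q.toFun c.dom f) =
      sgn (p * 1) • Q.toFun c.dom (X.toFun c.dom f) := fun f => by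
    have := LinearMap.congr_fun (hX c.dom) f
    rwa [superBracket, LinearMap.sub_apply, LinearMap.smul_apply, LinearMap.comp_apply,
      LinearMap.comp_apply, LinearMap.zero_apply, sub_eq_zero] at this
  have key := (c.superCoords le_rfl).apply_divergence (M.isSuper c.dom) (X.isSuperDer c.dom)
    (Q.isSuperDer c.dom) (X.expands c le_rfl) (Q.expands c le_rfl) hXQ (ρ.even c) (ρ.isUnit c)
    (isDivergence_divergence ρ X c) (isDivergence_divergence ρ Q c)
  rw [mul_one] at key
  rw [HomVectorField.apply, HomVectorField.apply, ← X.map_res, map_smul, ← Q.map_res, key]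

/-- The homogeneous components of a symmetry are symmetries. -/
theorem VectorField.IsSymmetry.components {X : VectorField M} {Q : HomVectorField M 1}
    (hX : X.IsSymmetry Q) : X.even.IsSymmetry Q ∧ X.odd.IsSymmetry Q := by
  have hmem : ∀ {p : ZMod 2} (Y : HomVectorField M p) (U : Opens M.space) (q : ZMod 2) (f : M.O U),
      f ∈ M.parity U q → superBracket Y Q U f ∈ M.parity U (p + 1 + q) := by
    intro p Y U q f hf
    have h1 := Y.map_parity U _ _ (Q.map_parity U q f hf)
    have h2 := Q.map_parity U _ _ (Y.map_parity U q f hf)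
    rw [← add_assoc] at h1 h2
    rw [add_comm 1 p] at h2
    exact Submodule.sub_mem _ h1 (Submodule.smul_mem _ _ h2)
  have hhom : ∀ (U : Opens M.space) (q : ZMod 2) (f : M.O U), f ∈ M.parity U q →
      superBracket X.even Q U f = 0 ∧ superBracket X.odd Q U f = 0 := by
    intro U q f hf
    have hs : superBracket X.even Q U f + superBracket X.odd Q U f = 0 :=
      LinearMap.congr_fun (hX U) f
    have he := hmem X.even U q f hf
    have ho := hmem X.odd U q f hf
    -- On homogeneous `f` the two brackets have opposite parities and sum to zero, so each is zero.
    have h0 : superBracket X.even Q U f = 0 := by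
      refine (M.isSuper U).eq_zero_of_mem he ?_
      rw [eq_neg_of_add_eq_zero_left hs]
      have : (0 : ZMod 2) + 1 + q + 1 = 1 + 1 + q := by ring
      rw [this]
      exact Submodule.neg_mem _ ho
    exact ⟨h0, by rwa [h0, zero_add] at hs⟩
  constructor
  all_goals
    intro U
    ext f
    obtain ⟨a, ha, b, hb, rfl⟩ := (M.isSuper U).exists_add f
    simp only [map_add, (hhom U 0 a ha).1, (hhom U 1 b hb).1, (hhom U 0 a ha).2,
      (hhom U 1 b hb).2, LinearMap.zero_apply, add_zero]

end

end SuperGeom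

theorem mainTheorem5 {n m : ℕ} (M : SuperGeom.Supermanifold.{u} n m)
    (Q : SuperGeom.HomVectorField M 1) (hQ : SuperGeom.IsHomological Q)
    (ρ : SuperGeom.BerezinVolume M) :
    (∀ (p : ZMod 2) (X : SuperGeom.HomVectorField M p),
      SuperGeom.IsDivergence ρ X (SuperGeom.divergence ρ X) ∧
        ∀ f : M.Functions, SuperGeom.IsDivergence ρ X f → f = SuperGeom.divergence ρ X) ∧
    (∀ (p : ZMod 2) (X : SuperGeom.HomVectorField M p), X.IsSymmetry Q →
      X.apply (SuperGeom.divergence ρ Q) =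
        SuperGeom.sgn p • Q.apply (SuperGeom.divergence ρ X)) ∧
    (∀ X : SuperGeom.VectorField M, X.IsSymmetry Q →
      SuperGeom.IsExact Q (X.apply (SuperGeom.divergence ρ Q))) := by
  refine ⟨fun p X => ⟨SuperGeom.isDivergence_divergence ρ X, fun f hf =>
    hf.unique (SuperGeom.isDivergence_divergence ρ X)⟩,
    fun p X hX => SuperGeom.apply_divergence_of_isSymmetry ρ hX, fun X hX => ?_⟩
  obtain ⟨he, ho⟩ := hX.components
  -- The primitive is `Div X₀ - Div X₁`, the signs being those of the homogeneous case.
  refine ⟨SuperGeom.sgn 0 • SuperGeom.divergence ρ X.even +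
    SuperGeom.sgn 1 • SuperGeom.divergence ρ X.odd, ?_⟩
  rw [SuperGeom.VectorField.apply, SuperGeom.apply_divergence_of_isSymmetry ρ he,
    SuperGeom.apply_divergence_of_isSymmetry ρ ho]
  simp only [SuperGeom.HomVectorField.apply, map_add, map_smul]
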